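/- Let $G=(X,E)$ be a finite connected graph with vertex degrees $d_u$, and let $\Delta$ be its symmetrized Laplace matrix: $\Delta(u,u)=1$, $\Delta(u,v)=-1/\sqrt{d_ud_v}$ if $uv\in E$, and $\Delta(u,v)=0$ otherwise. Let $x,y,z\in X$ be three distinct vertices (the wells) with $d(x,y)=d(x,z)=d(y,z)=a$ that are pairwise $a$-cospectral, i.e. for every $0\le k\le a$ the probability that the simple random walk started at a well is back at its starting point at time $k$ is the same for the three wells. Let $W=1$ at the wells and $W=0$ elsewhere, and for real $Q$ put $H=\Delta-QW$. For wells $u\ne v$ let $\varphi_t=e^{itH}\chi_u$ (the solution of $-i\frac{d}{dt}\varphi_t=H\varphi_t$ started from the pure state $\chi_u$), and $$TC(u,v)=\liminf_{Q\to\infty}\ \sup_{t\in[0,\infty)}|\varphi_t(v)|^2 .$$ Tunneling from $u$ to $v$ is perfect if $TC(u,v)=1$ and partial if $0<TC(u,v)<1$; it happens within time $f(Q)$ if $TC(u,v)=\liminf_{Q\to\infty}\sup_{t\in[0,f(Q)]}|\varphi_t(v)|^2$. Finally let $$c_{uv}=\sum_{P}\ \prod_{j=0}^{d(u,v)-1}\frac1{\sqrt{d_{x_j}d_{x_{j+1}}}},$$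 the sum being over all paths $P:\ u=x_0,x_1,\dots,x_{d(u,v)}=v$ of length $d(u,v)$ in $G$. Then: 1. If $c_{xy}\neq c_{xz}$, then tunneling from $y$ to $z$ is partial. 2. If $c_{xy}=c_{xz}$ and $\sqrt{c_{yz}^2+8c_{xz}^2}$ is irrational, then tunneling from $y$ to $z$ is perfect, and every $f$ such that it happens within time $f(Q)$ satisfies $Q^{a-1}=o(f(Q))$ as $Q\to\infty$. 3. If $c_{xy}=c_{xz}$ is rational (rationality is automatic if the wells have equal degrees, e.g. if $G$ is regular or vertex-transitive) and $\sqrt{c_{yz}^2+8c_{xz}^2}$ is rational, then, if tunneling from $y$ to $z$ is perfect, every $f$ such that it happens within time $f(Q)$ satisfies $Q^{a}=O(f(Q))$ as $Q\to\infty$. In particular, if $c_{xy}=c_{xz}=c_{yz}$, then $\sqrt{c_{yz}^2+8c_{xz}^2}$ is rational and this conclusion holds. -/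

import Mathlib

open Filter Asymptotics Topology

noncomputable section

namespace GraphTunneling

/-- Symmetrized Laplace matrix: `1` on the diagonal, `-1/√(d_u d_v)` on edges, `0` elsewhere. -/
def laplacian {V : Type*} [Fintype V] [DecidableEq V] (G : SimpleGraph V) [DecidableRel G.Adj] :
    Matrix V V ℝ :=
  Matrix.of fun u v =>
    if u = v then 1
    else if G.Adj u v then -1 / Real.sqrt ((G.degree u : ℝ) * (G.degree v : ℝ))
    else 0

/-- The Hamiltonian `H = Δ - Q W`, where `W` acts as a diagonal matrix. -/
def hamiltonian {V : Type*} [Fintype V] [DecidableEq V] (G : SimpleGraph V) [DecidableRel G.Adj]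
    (W : V → ℝ) (Q : ℝ) : Matrix V V ℝ :=
  laplacian G - Matrix.diagonal fun v => Q * W v

/-- The state `φ_t = e^{itH} χ_u` at time `t`, that is, the solution of `-i dφ_t/dt = H φ_t` that
starts from the pure state `χ_u` of the vertex `u`. -/
def state {V : Type*} [Fintype V] [DecidableEq V] (G : SimpleGraph V) [DecidableRel G.Adj]
    (W : V → ℝ) (Q : ℝ) (u : V) (t : ℝ) : V → ℂ :=
  (NormedSpace.exp ((Complex.I * (t : ℂ)) •
    (hamiltonian G W Q).map (fun r : ℝ => (r : ℂ)))).mulVec (Pi.single u (1 : ℂ))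

/-- The probability `|φ_t(v)|²` of finding at `v`, at time `t`, the particle started from `u`. -/
def prob {V : Type*} [Fintype V] [DecidableEq V] (G : SimpleGraph V) [DecidableRel G.Adj]
    (W : V → ℝ) (Q : ℝ) (u v : V) (t : ℝ) : ℝ :=
  ‖state G W Q u t v‖ ^ 2

/-- The tunneling coefficient
`TC(u,v) = liminf_{Q → ∞} sup_{t ∈ [0,∞)} |φ_t(v)|²`. All probabilities lie in `[0,1]`. -/
def tunnelingCoefficient {V : Type*} [Fintype V] [DecidableEq V] (G : SimpleGraph V)
    [DecidableRel G.Adj] (W : V → ℝ) (u v : V) : ℝ :=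
  liminf (fun Q : ℝ => sSup (prob G W Q u v '' Set.Ici 0)) atTop

/-- Perfect (asymptotic) tunneling from `u` to `v`. -/
def PerfectTunneling {V : Type*} [Fintype V] [DecidableEq V] (G : SimpleGraph V)
    [DecidableRel G.Adj] (W : V → ℝ) (u v : V) : Prop :=
  tunnelingCoefficient G W u v = 1

/-- Partial tunneling from `u` to `v`. -/
def PartialTunneling {V : Type*} [Fintype V] [DecidableEq V] (G : SimpleGraph V)
    [DecidableRel G.Adj] (W : V → ℝ) (u v : V) : Prop :=
  0 < tunnelingCoefficient G W u v ∧ tunnelingCoefficient G W u v < 1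

/-- The tunneling from `u` to `v` happens within time `f(Q)`: restricting the times to
`[0, f(Q)]` does not change the tunneling coefficient. -/
def TunnelsWithin {V : Type*} [Fintype V] [DecidableEq V] (G : SimpleGraph V)
    [DecidableRel G.Adj] (W : V → ℝ) (u v : V) (f : ℝ → ℝ) : Prop :=
  tunnelingCoefficient G W u v =
    liminf (fun Q : ℝ => sSup (prob G W Q u v '' Set.Icc 0 (f Q))) atTop

/-- The simple potential whose wells are the vertices in `L`. -/
def wellPotential {V : Type*} [DecidableEq V] (L : Finset V) : V → ℝ :=
  fun v => if v ∈ L then 1 else 0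

/-- Transition matrix of the simple random walk. -/
def walkMatrix {V : Type*} [Fintype V] [DecidableEq V] (G : SimpleGraph V) [DecidableRel G.Adj] :
    Matrix V V ℝ :=
  Matrix.of fun u v => if G.Adj u v then 1 / (G.degree u : ℝ) else 0

/-- `PR(u,k)`: the probability that the simple random walk started at `u` is at `u` at time `k`. -/
def returnProb {V : Type*} [Fintype V] [DecidableEq V] (G : SimpleGraph V) [DecidableRel G.Adj]
    (u : V) (k : ℕ) : ℝ :=
  (walkMatrix G ^ k) u u

/-- `u` and `v` are `m`-cospectral: equal return probabilities up to time `m`. -/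
def Cospectral {V : Type*} [Fintype V] [DecidableEq V] (G : SimpleGraph V) [DecidableRel G.Adj]
    (m : ℕ) (u v : V) : Prop :=
  ∀ k ≤ m, returnProb G u k = returnProb G v k

/-- The weight `∏_j 1/√(d_{x_j} d_{x_{j+1}})` of a walk `x_0, x_1, …, x_l`. -/
def walkWeight {V : Type*} [Fintype V] [DecidableEq V] (G : SimpleGraph V) [DecidableRel G.Adj]
    {u v : V} (p : G.Walk u v) : ℝ :=
  (p.darts.map fun e => 1 / Real.sqrt ((G.degree e.fst : ℝ) * (G.degree e.snd : ℝ))).prod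

/-- `c_{uv}`: the total weight of all walks from `u` to `v` of the shortest length `d(u,v)`. -/
def geodesicWeight {V : Type*} [Fintype V] [DecidableEq V] (G : SimpleGraph V)
    [DecidableRel G.Adj] (u v : V) : ℝ :=
  ∑ p ∈ G.finsetWalkLength (G.dist u v) u v, walkWeight G p

end GraphTunneling

end

/-! Write `A` for the normalized adjacency matrix, `P` for the projection on the wells, `C` for the
symmetric matrix of the weights `c_{uv}` between distinct wells, and `a = n + 1`. Then `H = 1 - (Q P
+ A)`.

Eliminating the complement of the wells leaves the compressions `P A ((1 - P) A)^k P`, which weigh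
the walks that avoid the wells in between. For `k < n` they are scalar multiples of `P`: the
distances kill the off-diagonal entries and cospectrality equalizes the diagonal ones. At `k = n`
the matrix `C` appears (`exists_wellProj_avoiding`). A truncated Neumann series then gives `J = P +
O(1/Q)` with `(Q P + A) J = J (μ + Q^{-n} C) + O(Q^{-n-1})` (`exists_quasiMode`). By Duhamel's
formula the transition amplitude between wells at time `t` agrees in modulus with that of
`e^{-iτC}`, `τ = t Q^{-n}`, up to `O(1/Q) + O(t Q^{-n-1})` (`abs_norm_state_sub_le`). Tunneling is
never absent, because the limiting amplitude has derivative `-i c_{yz} ≠ 0` at `τ = 0`.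

An upper bound for all times cannot come from Duhamel. Instead, the evolution preserves the moments
of `H`: nearly perfect transfer from `y` to `z` would force the diagonal entries of `C²` at `y` and
`z` to agree, that is, `c_{xy} = c_{xz}` (`exists_prob_le_of_coupling_sq_ne`).

If `c_{xy} = c_{xz} = c`, put `b = c_{yz}`, which is then rational (`exists_rat_geodesicWeight`),
and `s = √(b² + 8c²)`. Diagonalizing `C` shows that, up to a phase, the limiting amplitude is half
of `-1` plus a convex combination of two phases of frequencies `(3b ± s)/2`. Modulus `1` means that
both phases equal `-1`, which gives integers with `s P = 3 b R`, `P ≠ 0` and `P + R` odd. For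
irrational `s` this is impossible, yet density of `ℤα + ℤ` with `α = s/(3b)` brings the modulus
arbitrarily close to `1`; on bounded `τ`-intervals it stays away from `1`, so times of order `Q^n`
do not suffice. For rational `c` a parity argument excludes the relation; if `s` is rational too,
the amplitude is periodic and has a uniform gap below `1`, which only the error `O(t Q^{-n-1})` can
close. -/

noncomputable section

namespace GraphTunneling

set_option linter.unusedSectionVars false

/-! ### Normalized adjacency matrix, walk weights, rationality and locality. -/

section Graph

variable {V : Type*} [Fintype V] [DecidableEq V] (G : SimpleGraph V) [DecidableRel G.Adj]

/-- Normalized adjacency matrix, with entries `1/√(d_u d_v)` on edges. -/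
def normAdj : Matrix V V ℝ :=
  Matrix.of fun u v =>
    if G.Adj u v then 1 / Real.sqrt ((G.degree u : ℝ) * (G.degree v : ℝ)) else 0

lemma laplacian_eq : laplacian G = 1 - normAdj G := by
  ext u v
  by_cases h : u = v
  · subst h; simp [laplacian, normAdj]
  · by_cases h' : G.Adj u v
    · simp [laplacian, normAdj, h, h', neg_div]
    · simp [laplacian, normAdj, h, h']

lemma normAdj_symm (u v : V) : normAdj G u v = normAdj G v u := by
  simp only [normAdj, Matrix.of_apply, G.adj_comm u v, mul_comm]

lemma normAdj_transpose : (normAdj G).transpose = normAdj G := by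
  ext u v; exact normAdj_symm G v u

lemma normAdj_pow_apply (n : ℕ) (u v : V) :
    (normAdj G ^ n) u v = ∑ p ∈ G.finsetWalkLength n u v, walkWeight G p := by
  induction n generalizing u with
  | zero => obtain rfl | h := eq_or_ne u v <;> simp [SimpleGraph.finsetWalkLength, walkWeight, *]
  | succ n ih =>
    rw [pow_succ', Matrix.mul_apply, SimpleGraph.finsetWalkLength, Finset.sum_biUnion]
    · simp only [Finset.sum_map, ih]
      have h : ∀ w : V, normAdj G u w * ∑ p ∈ G.finsetWalkLength n w v, walkWeight G p
          = if h : G.Adj u w then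
              ∑ p ∈ G.finsetWalkLength n w v, walkWeight G (SimpleGraph.Walk.cons h p) else 0 := by
        intro w
        by_cases h : G.Adj u w
        · simp [normAdj, h, walkWeight, Finset.mul_sum]
        · simp [normAdj, h]
      simp only [h]
      symm
      refine Finset.sum_of_injOn (Subtype.val : G.neighborSet u → V)
        Subtype.val_injective.injOn (fun _ _ => Finset.mem_coe.2 (Finset.mem_univ _)) ?_ ?_
      · intro w _ hw
        have : ¬ G.Adj u w := fun h => hw ⟨⟨w, h⟩, Finset.mem_coe.2 (Finset.mem_univ _), rfl⟩
        simp [this]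
      · rintro ⟨w, hw⟩ _
        have hw' : G.Adj u w := hw
        simp only [hw', dif_pos]
        rfl
    · rintro ⟨x, hx⟩ - ⟨y, hy⟩ - hxy
      rw [Function.onFun, disjoint_iff_inf_le]
      intro p hp
      simp only [Finset.inf_eq_inter, Finset.mem_inter, Finset.mem_map] at hp
      obtain ⟨⟨px, _, rfl⟩, ⟨py, hpy, hp⟩⟩ := hp
      cases hp
      simp at hxy

lemma geodesicWeight_eq (u v : V) :
    geodesicWeight G u v = (normAdj G ^ G.dist u v) u v :=
  (normAdj_pow_apply G _ u v).symm

variable {G}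

lemma degree_pos_of_adj {u v : V} (h : G.Adj u v) : 0 < (G.degree u : ℝ) :=
  Nat.cast_pos.2 ((G.degree_pos_iff_exists_adj u).2 ⟨v, h⟩)

lemma walkWeight_pos {u v : V} (p : G.Walk u v) : 0 < walkWeight G p := by
  unfold walkWeight
  apply List.prod_pos
  intro r hr
  obtain ⟨e, -, rfl⟩ := List.mem_map.1 hr
  have h1 := degree_pos_of_adj e.adj
  have h2 := degree_pos_of_adj e.adj.symm
  positivity

lemma geodesicWeight_pos (hG : G.Connected) (u v : V) : 0 < geodesicWeight G u v := by
  unfold geodesicWeight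
  refine Finset.sum_pos (fun p _ => walkWeight_pos p) ?_
  obtain ⟨p, hp⟩ := hG.exists_walk_length_eq_dist u v
  exact ⟨p, SimpleGraph.mem_finsetWalkLength_iff.2 hp⟩

lemma geodesicWeight_symm (u v : V) : geodesicWeight G u v = geodesicWeight G v u := by
  rw [geodesicWeight_eq, geodesicWeight_eq, SimpleGraph.dist_comm,
    ← Matrix.transpose_apply (normAdj G ^ _), Matrix.transpose_pow, normAdj_transpose]

/-- Real symmetrization of the random walk by the square roots of the degrees. -/
lemma normAdj_pow_mul_sqrt (k : ℕ) (u v : V) :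
    (normAdj G ^ k) u v * √(G.degree v : ℝ) = √(G.degree u : ℝ) * (walkMatrix G ^ k) u v := by
  induction k generalizing u with
  | zero => obtain rfl | h := eq_or_ne u v <;> simp [*]
  | succ k ih =>
    rw [pow_succ', pow_succ', Matrix.mul_apply, Matrix.mul_apply, Finset.sum_mul, Finset.mul_sum]
    refine Finset.sum_congr rfl fun w _ => ?_
    rw [mul_assoc, ih]
    by_cases h : G.Adj u w
    · generalize (walkMatrix G ^ k) w v = r
      simp only [normAdj, walkMatrix, Matrix.of_apply, h, if_true]
      have h1 : 0 < √(G.degree u : ℝ) := Real.sqrt_pos.2 (degree_pos_of_adj h)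
      have h2 : 0 < √(G.degree w : ℝ) := Real.sqrt_pos.2 (degree_pos_of_adj h.symm)
      have h3 : 1 / (G.degree u : ℝ) = 1 / √(G.degree u : ℝ) * (1 / √(G.degree u : ℝ)) := by
        rw [one_div_mul_one_div, Real.mul_self_sqrt (Nat.cast_nonneg _)]
      rw [Real.sqrt_mul (Nat.cast_nonneg _), h3]
      field_simp
    · simp [normAdj, walkMatrix, h]

lemma returnProb_eq (hd : ∀ u, 0 < G.degree u) (k : ℕ) (u : V) :
    returnProb G u k = (normAdj G ^ k) u u := by
  have h := normAdj_pow_mul_sqrt (G := G) k u u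
  have h1 : √(G.degree u : ℝ) ≠ 0 := (Real.sqrt_pos.2 (Nat.cast_pos.2 (hd u))).ne'
  rw [mul_comm] at h
  exact (mul_left_cancel₀ h1 h).symm

/-- Together with `normAdj_pow_mul_sqrt`, this confines the irrationality of a geodesic weight to
the factor `√(d_u / d_v)`. -/
lemma walkMatrix_pow_rat (k : ℕ) (u v : V) : ∃ q : ℚ, (walkMatrix G ^ k) u v = q := by
  have h : walkMatrix G = (algebraMap ℚ ℝ).mapMatrix
      (Matrix.of fun u v => if G.Adj u v then 1 / (G.degree u : ℚ) else 0) := by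
    ext u v
    by_cases h : G.Adj u v <;> simp [walkMatrix, h]
  rw [h, ← map_pow]
  exact ⟨_, rfl⟩

/-- Each weight satisfies `c_{uv} √d_v = √d_u q` with `q` rational. Dividing these relations for the
two equal weights shows that `√d_y / √d_z` is rational, and this is the only possibly irrational
factor of `c_{yz}`. -/
lemma exists_rat_geodesicWeight (hG : G.Connected) (hd : ∀ u, 0 < G.degree u) {x y z : V}
    (h : geodesicWeight G x y = geodesicWeight G x z) :
    ∃ q : ℚ, geodesicWeight G y z = q := by
  have hx := geodesicWeight_pos hG x y
  have hs : ∀ u, 0 < √(G.degree u : ℝ) := fun u => Real.sqrt_pos.2 (Nat.cast_pos.2 (hd u))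
  have e1 := normAdj_pow_mul_sqrt (G := G) (G.dist x y) x y
  have e2 := normAdj_pow_mul_sqrt (G := G) (G.dist x z) x z
  have e3 := normAdj_pow_mul_sqrt (G := G) (G.dist y z) y z
  rw [← geodesicWeight_eq] at e1 e2 e3
  obtain ⟨q1, h1⟩ := walkMatrix_pow_rat (G := G) (G.dist x y) x y
  obtain ⟨q2, h2⟩ := walkMatrix_pow_rat (G := G) (G.dist x z) x z
  obtain ⟨q3, h3⟩ := walkMatrix_pow_rat (G := G) (G.dist y z) y z
  rw [h1] at e1; rw [h2, ← h] at e2; rw [h3] at e3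
  have hsx := hs x
  have hsy := hs y
  have hsz := hs z
  have hq2 : (q2 : ℝ) ≠ 0 := by
    intro h0
    rw [h0] at e2
    have : 0 < geodesicWeight G x y * √(G.degree z : ℝ) := by positivity
    rw [e2] at this
    simp at this
  have key : √(G.degree y : ℝ) * q2 = √(G.degree z : ℝ) * q1 := by
    have : (geodesicWeight G x y * √(G.degree x : ℝ)) * (√(G.degree y : ℝ) * q2)
        = (geodesicWeight G x y * √(G.degree x : ℝ)) * (√(G.degree z : ℝ) * q1) := by
      linear_combination (√(G.degree x : ℝ) * q2) * e1 - (√(G.degree x : ℝ) * q1) * e2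
    exact mul_left_cancel₀ (by positivity) this
  refine ⟨q1 * q3 / q2, ?_⟩
  push_cast
  rw [eq_div_iff hq2]
  have : √(G.degree z : ℝ) * (geodesicWeight G y z * q2) = √(G.degree z : ℝ) * (q1 * q3) := by
    linear_combination q2 * e3 + q3 * key
  exact mul_left_cancel₀ hsz.ne' this

/-- A matrix whose entries vanish at graph distance larger than `n`. -/
def BandedBy (G : SimpleGraph V) (n : ℕ) (X : Matrix V V ℝ) : Prop :=
  ∀ u v, n < G.dist u v → X u v = 0

lemma BandedBy.mul (hG : G.Connected) {m n : ℕ} {X Y : Matrix V V ℝ}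
    (hX : BandedBy G m X) (hY : BandedBy G n Y) : BandedBy G (m + n) (X * Y) := by
  intro u v h
  rw [Matrix.mul_apply]
  refine Finset.sum_eq_zero fun w _ => ?_
  have := hG.dist_triangle (u := u) (v := w) (w := v)
  by_cases h1 : m < G.dist u w
  · rw [hX _ _ h1, zero_mul]
  · rw [hY w v (by omega), mul_zero]

lemma bandedBy_diagonal (d : V → ℝ) : BandedBy G 0 (Matrix.diagonal d) := by
  intro u v h
  refine Matrix.diagonal_apply_ne _ ?_
  rintro rfl
  simp at h

lemma bandedBy_one : BandedBy G 0 (1 : Matrix V V ℝ) := by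
  rw [← Matrix.diagonal_one]; exact bandedBy_diagonal _

lemma BandedBy.pow (hG : G.Connected) {X : Matrix V V ℝ} (hX : BandedBy G 1 X) (k : ℕ) :
    BandedBy G k (X ^ k) := by
  induction k with
  | zero => simpa using bandedBy_one
  | succ k ih => rw [pow_succ]; exact ih.mul hG hX

lemma bandedBy_normAdj : BandedBy G 1 (normAdj G) := by
  intro u v h
  have : ¬ G.Adj u v := fun h' => by
    rw [SimpleGraph.dist_eq_one_iff_adj.2 h'] at h; exact lt_irrefl _ h
  simp [normAdj, this]

/-- The projection on the wells. -/
def wellProj (L : Finset V) : Matrix V V ℝ := Matrix.diagonal (wellPotential L)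

lemma wellPotential_mul_self (L : Finset V) (v : V) :
    wellPotential L v * wellPotential L v = wellPotential L v := by
  by_cases h : v ∈ L <;> simp [wellPotential, h]

lemma wellProj_mul_self (L : Finset V) : wellProj L * wellProj L = wellProj L := by
  simp [wellProj, wellPotential_mul_self]

lemma one_sub_wellProj (L : Finset V) :
    1 - wellProj L = Matrix.diagonal fun v => 1 - wellPotential L v := by
  rw [wellProj, ← Matrix.diagonal_one, Matrix.diagonal_sub]

end Graph

/-! ### Renewal decomposition and walks that avoid the wells. -/

/-- Decomposition of a power of `A` at the last visit to the range of `P`. -/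
lemma pow_succ_eq_renewal {R : Type*} [Ring R] (A P : R) (k : ℕ) :
    A ^ (k + 1) = A * ((1 - P) * A) ^ k
      + ∑ j ∈ Finset.range k, A ^ (j + 1) * P * A * ((1 - P) * A) ^ (k - 1 - j) := by
  induction k with
  | zero => simp
  | succ k ih =>
    rw [pow_succ', ih, Finset.sum_range_succ', mul_add, Finset.mul_sum]
    have h : ∀ j ∈ Finset.range k, A * (A ^ (j + 1) * P * A * ((1 - P) * A) ^ (k - 1 - j))
        = A ^ (j + 1 + 1) * P * A * ((1 - P) * A) ^ (k + 1 - 1 - (j + 1)) := by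
      intro j _
      rw [pow_succ' A (j + 1), show k + 1 - 1 - (j + 1) = k - 1 - j by omega]
      noncomm_ring
    rw [Finset.sum_congr rfl h, pow_succ' ((1 - P) * A) k]
    simp only [zero_add, pow_one, Nat.sub_zero, Nat.add_sub_cancel]
    noncomm_ring

section Wells

variable {V : Type*} [Fintype V] [DecidableEq V] {G : SimpleGraph V} [DecidableRel G.Adj]

/-- Weights of the walks of length `k+1` that avoid the wells at the times `1, …, k`. -/
def avoiding (G : SimpleGraph V) [DecidableRel G.Adj] (L : Finset V) (k : ℕ) : Matrix V V ℝ :=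
  normAdj G * ((1 - wellProj L) * normAdj G) ^ k

lemma bandedBy_avoiding (hG : G.Connected) (L : Finset V) (k : ℕ) :
    BandedBy G (k + 1) (avoiding G L k) := by
  have h : BandedBy G 1 ((1 - wellProj L) * normAdj G) := by
    rw [one_sub_wellProj]
    simpa using (bandedBy_diagonal _).mul hG bandedBy_normAdj
  rw [add_comm]
  exact bandedBy_normAdj.mul hG (h.pow hG k)

lemma wellProj_mul_mul_apply (L : Finset V) (X Y : Matrix V V ℝ) (u v : V) :
    (X * wellProj L * Y) u v = ∑ w ∈ L, X u w * Y w v := by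
  rw [Matrix.mul_apply, ← Finset.sum_subset (Finset.subset_univ L)]
  · refine Finset.sum_congr rfl fun w hw => ?_
    simp [wellProj, Matrix.mul_diagonal, wellPotential, hw]
  · intro w _ hw
    simp [wellProj, Matrix.mul_diagonal, wellPotential, hw]

lemma normAdj_pow_renewal (L : Finset V) (k : ℕ) (u v : V) :
    (normAdj G ^ (k + 1)) u v = avoiding G L k u v
      + ∑ j ∈ Finset.range k, ∑ w ∈ L,
          (normAdj G ^ (j + 1)) u w * avoiding G L (k - 1 - j) w v := by
  rw [pow_succ_eq_renewal (normAdj G) (wellProj L) k, Matrix.add_apply, Matrix.sum_apply]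
  congr 1
  refine Finset.sum_congr rfl fun j _ => ?_
  rw [mul_assoc _ (normAdj G), wellProj_mul_mul_apply]
  rfl

variable {L : Finset V} {a : ℕ}

/-- A walk of length at most `a` between distinct wells has no room for an intermediate well `w`: if
`w = v` the first leg is shorter than `a`, otherwise the last leg is. -/
lemma avoiding_eq_normAdj_pow (hG : G.Connected)
    (hL : ∀ u ∈ L, ∀ v ∈ L, u ≠ v → G.dist u v = a) {k : ℕ} (hk : k + 1 ≤ a)
    {u v : V} (hu : u ∈ L) (hv : v ∈ L) (huv : u ≠ v) :
    avoiding G L k u v = (normAdj G ^ (k + 1)) u v := by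
  rw [normAdj_pow_renewal L, Finset.sum_eq_zero, add_zero]
  intro j hj
  have hj := Finset.mem_range.1 hj
  refine Finset.sum_eq_zero fun w hw => ?_
  by_cases h : w = v
  · subst h
    rw [(bandedBy_normAdj.pow hG (j + 1)) u w (by rw [hL u hu w hw huv]; omega), zero_mul]
  · rw [(bandedBy_avoiding hG L (k - 1 - j)) w v (by rw [hL w hw v hv h]; omega), mul_zero]

/-- In a closed walk of length at most `a` the only well that can be met in between is `u` itself,
so the renewal equation closes on the diagonal entry at `u`. -/
lemma normAdj_pow_diag (hG : G.Connected)
    (hL : ∀ u ∈ L, ∀ v ∈ L, u ≠ v → G.dist u v = a) {k : ℕ} (hk : k + 1 ≤ a)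
    {u : V} (hu : u ∈ L) :
    (normAdj G ^ (k + 1)) u u = avoiding G L k u u
      + ∑ j ∈ Finset.range k, (normAdj G ^ (j + 1)) u u * avoiding G L (k - 1 - j) u u := by
  rw [normAdj_pow_renewal L]
  congr 1
  refine Finset.sum_congr rfl fun j hj => ?_
  have hj := Finset.mem_range.1 hj
  refine Finset.sum_eq_single_of_mem u hu fun w hw h => ?_
  rw [(bandedBy_normAdj.pow hG (j + 1)) u w (by rw [hL u hu w hw h.symm]; omega), zero_mul]

/-- The diagonal renewal equation is triangular: it recovers the first-return weights from the
return weights, so equality of the latter passes to the former. -/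
lemma avoiding_diag_eq (hG : G.Connected)
    (hL : ∀ u ∈ L, ∀ v ∈ L, u ≠ v → G.dist u v = a)
    {u v : V} (hu : u ∈ L) (hv : v ∈ L)
    (hA : ∀ k ≤ a, (normAdj G ^ k) u u = (normAdj G ^ k) v v) (k : ℕ) (hk : k + 1 ≤ a) :
    avoiding G L k u u = avoiding G L k v v := by
  induction k using Nat.strong_induction_on with
  | _ k ih =>
    have h1 := normAdj_pow_diag hG hL hk hu
    have h2 := normAdj_pow_diag hG hL hk hv
    have h3 : ∑ j ∈ Finset.range k, (normAdj G ^ (j + 1)) u u * avoiding G L (k - 1 - j) u u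
        = ∑ j ∈ Finset.range k, (normAdj G ^ (j + 1)) v v * avoiding G L (k - 1 - j) v v := by
      refine Finset.sum_congr rfl fun j hj => ?_
      have hj := Finset.mem_range.1 hj
      rw [hA _ (by omega), ih _ (by omega) (by omega)]
    have h4 := hA _ hk
    linarith

/-- The coupling matrix of the wells: `c_{uv}` for distinct wells, `0` elsewhere. -/
def coupling (G : SimpleGraph V) [DecidableRel G.Adj] (L : Finset V) : Matrix V V ℝ :=
  Matrix.of fun u v => if u ∈ L ∧ v ∈ L ∧ u ≠ v then geodesicWeight G u v else 0

lemma coupling_transpose : (coupling G L).transpose = coupling G L := by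
  ext u v
  simp only [coupling, Matrix.transpose_apply, Matrix.of_apply, geodesicWeight_symm v u]
  congr 1
  rw [ne_comm]
  apply propext
  tauto

lemma wellProj_mul_coupling : wellProj L * coupling G L = coupling G L := by
  ext u v
  by_cases h : u ∈ L <;>
    simp [wellProj, Matrix.diagonal_mul, wellPotential, coupling, h]

lemma wellProj_avoiding_apply (k : ℕ) (u v : V) :
    (wellProj L * avoiding G L k * wellProj L) u v
      = if u ∈ L ∧ v ∈ L then avoiding G L k u v else 0 := by
  rw [wellProj, Matrix.mul_diagonal, Matrix.diagonal_mul]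
  by_cases h1 : u ∈ L <;> by_cases h2 : v ∈ L <;> simp [wellPotential, h1, h2]

/-- This is where geometry enters the spectral problem: below order `n` the compressions cannot tell
the wells apart, and at order `n` they do so through the geodesic weights only. -/
lemma exists_wellProj_avoiding (hG : G.Connected) {n : ℕ}
    (hL : ∀ u ∈ L, ∀ v ∈ L, u ≠ v → G.dist u v = n + 1)
    (hA : ∀ u ∈ L, ∀ v ∈ L, ∀ k ≤ n + 1, (normAdj G ^ k) u u = (normAdj G ^ k) v v) :
    ∃ s : ℕ → ℝ, (∀ k < n, wellProj L * avoiding G L k * wellProj L = s k • wellProj L) ∧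
      wellProj L * avoiding G L n * wellProj L = s n • wellProj L + coupling G L := by
  rcases L.eq_empty_or_nonempty with rfl | ⟨w, hw⟩
  · refine ⟨0, fun k _ => ?_, ?_⟩ <;> ext u v <;>
      simp [wellProj_avoiding_apply, coupling]
  · have hdiag : ∀ k ≤ n, ∀ u ∈ L, avoiding G L k u u = avoiding G L k w w := fun k hk u hu =>
      avoiding_diag_eq hG hL hu hw (hA u hu w hw) k (by omega)
    refine ⟨fun k => avoiding G L k w w, fun k hk => ?_, ?_⟩
    · ext u v
      rw [wellProj_avoiding_apply]
      by_cases hu : u ∈ L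
      · by_cases hv : v ∈ L
        · by_cases huv : u = v
          · subst huv
            simp [hu, wellProj, wellPotential, hdiag k hk.le u hu]
          · rw [avoiding_eq_normAdj_pow hG hL (by omega) hu hv huv,
              (bandedBy_normAdj.pow hG _) u v (by rw [hL u hu v hv huv]; omega)]
            simp [wellProj, huv]
        · have huv : u ≠ v := fun h => hv (h ▸ hu)
          simp [wellProj, huv, hv]
      · simp [wellProj, Matrix.diagonal_apply, wellPotential, hu]
    · ext u v
      rw [wellProj_avoiding_apply]
      by_cases hu : u ∈ L
      · by_cases hv : v ∈ L
        · by_cases huv : u = v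
          · subst huv
            simp [hu, wellProj, wellPotential, hdiag n le_rfl u hu, coupling]
          · rw [avoiding_eq_normAdj_pow hG hL (by omega) hu hv huv]
            simp [wellProj, huv, coupling, hu, hv, geodesicWeight_eq, hL u hu v hv huv]
        · have huv : u ≠ v := fun h => hv (h ▸ hu)
          simp [wellProj, huv, hv, coupling]
      · simp [wellProj, Matrix.diagonal_apply, wellPotential, hu, coupling]

end Wells

/-! ### Approximate invariant subspaces of `Q P + A`. -/

section QuasiModes

variable {R : Type*} [NormedRing R] [NormedAlgebra ℝ R]

/-- Truncated Neumann series of the eigenvectors of `Q P + A` with eigenvalue near `u⁻¹`. -/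
def quasiMode (A P : R) (m : ℕ) (u : ℝ) : R :=
  ∑ k ∈ Finset.range m, u ^ k • (((1 - P) * A) ^ k * P)

lemma quasiMode_sub (A P : R) (n : ℕ) (u : ℝ) :
    quasiMode A P (n + 1) u - P
      = u • ∑ k ∈ Finset.range n, u ^ k • (((1 - P) * A) ^ (k + 1) * P) := by
  rw [quasiMode, Finset.sum_range_succ', Finset.smul_sum]
  simp [pow_succ', mul_smul]

lemma norm_quasiMode_sub_le (A P : R) (n : ℕ) {u : ℝ} (h0 : 0 ≤ u) (h1 : u ≤ 1) :
    ‖quasiMode A P (n + 1) u - P‖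
      ≤ u * ∑ k ∈ Finset.range n, ‖((1 - P) * A) ^ (k + 1) * P‖ := by
  rw [quasiMode_sub, norm_smul, Real.norm_of_nonneg h0]
  gcongr
  refine (norm_sum_le _ _).trans (Finset.sum_le_sum fun k _ => ?_)
  rw [norm_smul, Real.norm_of_nonneg (by positivity)]
  exact mul_le_of_le_one_left (norm_nonneg _) (pow_le_one₀ h0 h1)

/-- Split `Q P + A` as `Q P + P A + (1 - P) A`. Since `P ((1 - P) A) = 0`, the first piece sees only
the leading term of the series; the second produces the compressions; the third shifts the series by
one step and leaves a tail of order `u^(n+1)`. -/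
lemma mul_quasiMode {A P C : R} {n : ℕ} {s : ℕ → ℝ} (hP : P * P = P)
    (hs : ∀ k < n, P * (A * ((1 - P) * A) ^ k) * P = s k • P)
    (hn : P * (A * ((1 - P) * A) ^ n) * P = s n • P + C) (Q : ℝ) {u : ℝ} (hu : u ≠ 0) :
    (Q • P + A) * quasiMode A P (n + 2) u
      = u⁻¹ • quasiMode A P (n + 2) u
        + (Q - u⁻¹ + ∑ k ∈ Finset.range (n + 1), u ^ k * s k) • P + u ^ n • C
        + u ^ (n + 1) • (P * (A * ((1 - P) * A) ^ (n + 1)) * P + ((1 - P) * A) ^ (n + 2) * P) := by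
  have hPD : P * ((1 - P) * A) = 0 := by
    rw [← mul_assoc, mul_sub, hP, mul_one, sub_self, zero_mul]
  have h1 : P * quasiMode A P (n + 2) u = P := by
    rw [quasiMode, Finset.mul_sum, Finset.sum_range_succ', Finset.sum_eq_zero]
    · simp [hP]
    · intro k _
      rw [pow_succ' ((1 - P) * A), mul_smul_comm, mul_assoc ((1 - P) * A), ← mul_assoc P, hPD,
        zero_mul, smul_zero]
  have h2 : P * A * quasiMode A P (n + 2) u
      = (∑ k ∈ Finset.range (n + 1), u ^ k * s k) • P + u ^ n • C
        + u ^ (n + 1) • (P * (A * ((1 - P) * A) ^ (n + 1)) * P) := by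
    have h : ∀ k, P * A * (u ^ k • (((1 - P) * A) ^ k * P))
        = u ^ k • (P * (A * ((1 - P) * A) ^ k) * P) := by
      intro k
      rw [mul_smul_comm]
      congr 1
      simp only [mul_assoc]
    rw [quasiMode, Finset.mul_sum]
    simp only [h]
    rw [Finset.sum_range_succ, Finset.sum_range_succ, hn, Finset.sum_range_succ, add_smul,
      Finset.sum_smul]
    have h' : ∀ k ∈ Finset.range n, u ^ k • (P * (A * ((1 - P) * A) ^ k) * P)
        = (u ^ k * s k) • P := by
      intro k hk
      rw [hs k (Finset.mem_range.1 hk), smul_smul]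
    rw [Finset.sum_congr rfl h', smul_add, smul_smul]
    abel
  have h3 : (1 - P) * A * quasiMode A P (n + 2) u
      = u⁻¹ • quasiMode A P (n + 2) u - u⁻¹ • P
        + u ^ (n + 1) • (((1 - P) * A) ^ (n + 2) * P) := by
    rw [← smul_sub, quasiMode_sub, smul_smul, inv_mul_cancel₀ hu, one_smul, quasiMode,
      Finset.mul_sum, Finset.sum_range_succ]
    congr 1
    · refine Finset.sum_congr rfl fun k _ => ?_
      rw [mul_smul_comm, ← mul_assoc, ← pow_succ']
    · rw [mul_smul_comm, ← mul_assoc, ← pow_succ']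
  have h4 : (Q • P + A) * quasiMode A P (n + 2) u
      = Q • (P * quasiMode A P (n + 2) u) + P * A * quasiMode A P (n + 2) u
        + (1 - P) * A * quasiMode A P (n + 2) u := by
    rw [add_mul, smul_mul_assoc]
    noncomm_ring
  rw [h4, h1, h2, h3, add_smul, sub_smul, smul_add]
  abel

lemma abs_pow_sub_pow_le_of_le {u v S : ℝ} (hu : 0 ≤ u) (hv : 0 ≤ v) (huv : u ≤ 2 * v)
    (h : |u - v| ≤ S * v ^ 2) (n : ℕ) :
    |u ^ n - v ^ n| ≤ S * n * 2 ^ n * v ^ (n + 1) := by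
  have hS : 0 ≤ S * v ^ 2 := (abs_nonneg _).trans h
  cases n with
  | zero => simp
  | succ n =>
    refine (abs_pow_sub_pow_le u v (n + 1)).trans ?_
    have h1 : max |u| |v| ≤ 2 * v := by
      rw [abs_of_nonneg hu, abs_of_nonneg hv]
      exact max_le huv (by linarith)
    calc |u - v| * (n + 1 : ℕ) * max |u| |v| ^ (n + 1 - 1)
        ≤ S * v ^ 2 * (n + 1 : ℕ) * (2 * v) ^ (n + 1 - 1) := by gcongr
      _ = (S * v ^ 2) * (n + 1 : ℕ) * 2 ^ n * v ^ n := by rw [Nat.add_sub_cancel, mul_pow]; ring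
      _ ≤ (S * v ^ 2) * (n + 1 : ℕ) * 2 ^ (n + 1) * v ^ n := by
          gcongr <;> norm_num
      _ = _ := by ring

/-- Solvability of the scalar equation that fixes the mean eigenvalue. -/
lemma exists_mean_eigenvalue (s : ℕ → ℝ) (n : ℕ) :
    ∃ S : ℝ, 0 ≤ S ∧ ∀ Q ≥ 2 * S + 2, ∃ u : ℝ, 0 < u ∧ u ≤ 1 ∧ u ≤ 2 * Q⁻¹ ∧
      |u - Q⁻¹| ≤ 2 * S * Q⁻¹ ^ 2 ∧
      Q - u⁻¹ + ∑ k ∈ Finset.range (n + 1), u ^ k * s k = 0 := by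
  set S := ∑ k ∈ Finset.range (n + 1), |s k| with hSdef
  have hS : 0 ≤ S := Finset.sum_nonneg fun _ _ => abs_nonneg _
  refine ⟨S, hS, fun Q hQ => ?_⟩
  have hbound : ∀ u : ℝ, 0 ≤ u → u ≤ 1 → |∑ k ∈ Finset.range (n + 1), u ^ k * s k| ≤ S := by
    intro u h0 h1
    refine (Finset.abs_sum_le_sum_abs _ _).trans (Finset.sum_le_sum fun k _ => ?_)
    rw [abs_mul, abs_of_nonneg (pow_nonneg h0 k)]
    exact mul_le_of_le_one_left (abs_nonneg _) (pow_le_one₀ h0 h1)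
  have hinv : ∀ μ ∈ Set.Icc (Q - S) (Q + S), 0 < μ ∧ 0 ≤ μ⁻¹ ∧ μ⁻¹ ≤ 1 := by
    intro μ hμ
    have h1 : 1 ≤ μ := by linarith [hμ.1]
    exact ⟨by linarith, by positivity, inv_le_one_of_one_le₀ h1⟩
  -- The equation is solved for `μ = u⁻¹` by the intermediate value theorem on `[Q - S, Q + S]`,
  -- since the sum is bounded by `S` there. The condition `Q ≥ 2 S + 2` gives both `μ ≥ 1` and `μ ≥
  -- Q / 2`.
  have hcont : ContinuousOn (fun μ : ℝ => μ - ∑ k ∈ Finset.range (n + 1), μ⁻¹ ^ k * s k)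
      (Set.Icc (Q - S) (Q + S)) := by
    refine continuousOn_id.sub (continuousOn_finsetSum _ fun k _ => ?_)
    exact ((continuousOn_id.inv₀ fun μ hμ => (hinv μ hμ).1.ne').pow k).mul continuousOn_const
  have hle : Q - S ≤ Q + S := by linarith
  obtain ⟨μ, hμ, hμQ⟩ := intermediate_value_Icc hle hcont (show Q ∈ Set.Icc _ _ from by
    obtain ⟨-, h1, h2⟩ := hinv (Q - S) (Set.left_mem_Icc.2 hle)
    obtain ⟨-, h3, h4⟩ := hinv (Q + S) (Set.right_mem_Icc.2 hle)
    have h5 := (abs_le.1 (hbound _ h1 h2)).1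
    have h6 := (abs_le.1 (hbound _ h3 h4)).2
    constructor <;> linarith)
  obtain ⟨h0, h1, h2⟩ := hinv μ hμ
  simp only at hμQ
  have hQ0 : 0 < Q := by linarith
  have hμ2 : Q / 2 ≤ μ := by linarith [hμ.1]
  have h3 : μ⁻¹ ≤ 2 * Q⁻¹ := by
    calc μ⁻¹ ≤ (Q / 2)⁻¹ := inv_anti₀ (by positivity) hμ2
      _ = 2 * Q⁻¹ := by rw [inv_div]; ring
  refine ⟨μ⁻¹, inv_pos.2 h0, h2, h3, ?_, ?_⟩
  · have h4 : μ⁻¹ - Q⁻¹ = (Q - μ) * μ⁻¹ * Q⁻¹ := by field_simp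
    have h5 : |Q - μ| ≤ S := abs_le.2 ⟨by linarith [hμ.2], by linarith [hμ.1]⟩
    rw [h4, abs_mul, abs_mul, abs_of_nonneg h1, abs_of_nonneg (inv_pos.2 hQ0).le]
    calc |Q - μ| * μ⁻¹ * Q⁻¹ ≤ S * (2 * Q⁻¹) * Q⁻¹ := by gcongr
      _ = _ := by ring
  · rw [inv_inv]; linarith

/-- Choosing `u` from `exists_mean_eigenvalue` cancels the multiple of `P` in `mul_quasiMode`. Three
defects of order `Q^{-n-1}` remain: `u^n` in place of `Q^{-n}`, `P C` in place of `J C`, and the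
tail of the series. -/
theorem exists_quasiMode {A P C : R} {n : ℕ} {s : ℕ → ℝ} (hP : P * P = P) (hC : P * C = C)
    (hs : ∀ k < n, P * (A * ((1 - P) * A) ^ k) * P = s k • P)
    (hn : P * (A * ((1 - P) * A) ^ n) * P = s n • P + C) :
    ∃ K Q₀ : ℝ, 0 ≤ K ∧ 1 ≤ Q₀ ∧ ∀ Q ≥ Q₀, ∃ (μ : ℝ) (J : R),
      ‖J - P‖ ≤ K / Q ∧
      ‖(Q • P + A) * J - J * (μ • 1 + (Q ^ n)⁻¹ • C)‖ ≤ K / Q ^ (n + 1) := by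
  obtain ⟨S, hS, hQ⟩ := exists_mean_eigenvalue s n
  set K₁ := ∑ k ∈ Finset.range (n + 1), ‖((1 - P) * A) ^ (k + 1) * P‖ with hK₁
  have hK₁0 : 0 ≤ K₁ := Finset.sum_nonneg fun _ _ => norm_nonneg _
  set R₀ := P * (A * ((1 - P) * A) ^ (n + 1)) * P + ((1 - P) * A) ^ (n + 2) * P with hR₀
  set K₂ := (2 * S) * n * 2 ^ n * ‖C‖ + 2 * K₁ * ‖C‖ + 2 ^ (n + 1) * ‖R₀‖ with hK₂
  have hK₂0 : 0 ≤ K₂ := by positivity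
  refine ⟨2 * K₁ + K₂, 2 * S + 2, by positivity, by linarith, fun Q hQQ => ?_⟩
  obtain ⟨u, hu0, hu1, hu2, huv, heq⟩ := hQ Q hQQ
  have hQ0 : 0 < Q := by linarith
  have hv : 0 < Q⁻¹ := inv_pos.2 hQ0
  refine ⟨u⁻¹, quasiMode A P (n + 2) u, ?_, ?_⟩
  · calc _ ≤ u * K₁ := norm_quasiMode_sub_le A P (n + 1) hu0.le hu1
      _ ≤ (2 * Q⁻¹) * K₁ := by gcongr
      _ ≤ (2 * K₁ + K₂) * Q⁻¹ := by nlinarith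
      _ = _ := by rw [div_eq_mul_inv]
  · set J := quasiMode A P (n + 2) u with hJ
    have hJP : ‖J - P‖ ≤ u * K₁ := norm_quasiMode_sub_le A P (n + 1) hu0.le hu1
    have h1 : (Q • P + A) * J - J * (u⁻¹ • 1 + (Q ^ n)⁻¹ • C)
        = (u ^ n - Q⁻¹ ^ n) • C - Q⁻¹ ^ n • ((J - P) * C) + u ^ (n + 1) • R₀ := by
      rw [mul_quasiMode hP hs hn Q hu0.ne', heq, zero_smul, mul_add, mul_smul_comm, mul_one,
        mul_smul_comm, sub_mul J, hC, sub_smul, smul_sub, inv_pow]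
      abel
    rw [h1]
    have h2 : ‖(u ^ n - Q⁻¹ ^ n) • C‖ ≤ (2 * S) * n * 2 ^ n * Q⁻¹ ^ (n + 1) * ‖C‖ := by
      rw [norm_smul, Real.norm_eq_abs]
      gcongr
      exact abs_pow_sub_pow_le_of_le hu0.le hv.le hu2 huv n
    have h3 : ‖Q⁻¹ ^ n • ((J - P) * C)‖ ≤ 2 * K₁ * ‖C‖ * Q⁻¹ ^ (n + 1) := by
      rw [norm_smul, Real.norm_of_nonneg (by positivity)]
      calc Q⁻¹ ^ n * ‖(J - P) * C‖ ≤ Q⁻¹ ^ n * (‖J - P‖ * ‖C‖) := by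
            gcongr; exact norm_mul_le _ _
        _ ≤ Q⁻¹ ^ n * ((2 * Q⁻¹) * K₁ * ‖C‖) := by
            gcongr
            exact hJP.trans (by gcongr)
        _ = _ := by ring
    have h4 : ‖u ^ (n + 1) • R₀‖ ≤ 2 ^ (n + 1) * ‖R₀‖ * Q⁻¹ ^ (n + 1) := by
      rw [norm_smul, Real.norm_of_nonneg (by positivity)]
      calc u ^ (n + 1) * ‖R₀‖ ≤ (2 * Q⁻¹) ^ (n + 1) * ‖R₀‖ := by gcongr
        _ = _ := by rw [mul_pow]; ring
    calc _ ≤ ‖(u ^ n - Q⁻¹ ^ n) • C‖ + ‖Q⁻¹ ^ n • ((J - P) * C)‖ + ‖u ^ (n + 1) • R₀‖ :=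
          (norm_add_le _ _).trans (by gcongr; exact norm_sub_le _ _)
      _ ≤ K₂ * Q⁻¹ ^ (n + 1) := by rw [hK₂]; linarith
      _ ≤ (2 * K₁ + K₂) * Q⁻¹ ^ (n + 1) := by gcongr; linarith
      _ = _ := by rw [inv_pow, div_eq_mul_inv]

end QuasiModes

/-! ### Unitary groups, Duhamel's estimate and conservation of second moments. -/

section Evolution

variable {R : Type*} [CStarAlgebra R]

/-- The one-parameter group `e^{itH}`. -/
def evol (H : R) (t : ℝ) : R := NormedSpace.exp ((Complex.I * (t : ℂ)) • H)

lemma evol_eq (H : R) (t : ℝ) : evol H t = NormedSpace.exp (t • (Complex.I • H)) := by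
  rw [evol, ← Complex.coe_smul t, smul_smul, mul_comm]

lemma evol_zero (H : R) : evol H 0 = 1 := by
  simp [evol]

lemma evol_mem_unitary {H : R} (hH : IsSelfAdjoint H) (t : ℝ) : evol H t ∈ unitary R := by
  let +nondep : NormedAlgebra ℚ R := .restrictScalars ℚ ℂ R
  refine NormedSpace.exp_mem_unitary_of_mem_skewAdjoint ?_
  rw [skewAdjoint.mem_iff, star_smul, hH.star_eq]
  simp

lemma hasDerivAt_evol (H : R) (t : ℝ) :
    HasDerivAt (evol H) (evol H t * (Complex.I • H)) t := by
  have h := hasDerivAt_exp_smul_const (𝕂 := ℝ) (Complex.I • H) t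
  simp only [← evol_eq] at h
  exact h

lemma continuous_evol (H : R) : Continuous (evol H) :=
  continuous_iff_continuousAt.2 fun t => (hasDerivAt_evol H t).continuousAt

lemma evol_add (H : R) (s t : ℝ) : evol H (s + t) = evol H s * evol H t := by
  let +nondep : NormedAlgebra ℚ R := .restrictScalars ℚ ℂ R
  rw [evol, evol, evol, ← NormedSpace.exp_add_of_commute, ← add_smul]
  · push_cast; rw [mul_add]
  · exact ((Commute.refl H).smul_left _).smul_right _

lemma evol_mul_evol_neg (H : R) (t : ℝ) : evol H t * evol H (-t) = 1 := by
  rw [← evol_add, add_neg_cancel, evol_zero]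

lemma commute_evol {H X : R} (h : Commute H X) (t : ℝ) : Commute (evol H t) X := by
  let +nondep : NormedAlgebra ℚ R := .restrictScalars ℚ ℂ R
  exact (h.smul_left _).exp_left

lemma evol_smul_one_add (r : ℝ) (X : R) (t : ℝ) :
    evol ((r : ℂ) • (1 : R) + X) t = Complex.exp (Complex.I * t * r) • evol X t := by
  let +nondep : NormedAlgebra ℚ R := .restrictScalars ℚ ℂ R
  rw [evol, smul_add, NormedSpace.exp_add_of_commute, smul_smul, ← Algebra.algebraMap_eq_smul_one,
    ← NormedSpace.algebraMap_exp_comm, Algebra.algebraMap_eq_smul_one, smul_mul_assoc, one_mul,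
    Complex.exp_eq_exp_ℂ]
  · rfl
  · rw [smul_smul]
    exact ((Commute.one_left X).smul_left _).smul_right _

lemma evol_smul (r : ℝ) (X : R) (t : ℝ) : evol ((r : ℂ) • X) t = evol X (t * r) := by
  rw [evol, evol, smul_smul]
  push_cast
  rw [mul_assoc]

/-- Duhamel's estimate for approximately intertwined evolutions. -/
lemma norm_evol_mul_sub_le {H N : R} (hH : IsSelfAdjoint H) (hN : IsSelfAdjoint N) (J : R)
    {t : ℝ} (ht : 0 ≤ t) :
    ‖evol H t * J - J * evol N t‖ ≤ t * ‖H * J - J * N‖ := by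
  -- The derivative of this interpolation is the defect `H J - J N` between two unitaries, so its
  -- norm is that of the defect at every time.
  set f : ℝ → R := fun s => evol H (-s) * J * evol N s with hf
  have hd : ∀ s, HasDerivAt f (evol H (-s) * (-(Complex.I • (H * J - J * N))) * evol N s) s := by
    intro s
    have h1 : HasDerivAt (fun s => evol H (-s)) (-(evol H (-s) * (Complex.I • H))) s := by
      have := (hasDerivAt_evol H (-s)).scomp s (hasDerivAt_neg s)
      simpa [Function.comp_def] using this
    have h2 := (h1.mul_const J).mul (hasDerivAt_evol N s)
    have h3 := (commute_evol (Commute.refl N) s).eq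
    refine h2.congr_deriv ?_
    rw [mul_smul_comm (Complex.I) (evol N s), h3]
    simp only [mul_smul_comm, smul_mul_assoc, smul_sub, mul_neg, neg_mul, mul_sub, sub_mul]
    simp only [mul_assoc]
    abel
  have hb : ∀ s, ‖evol H (-s) * (-(Complex.I • (H * J - J * N))) * evol N s‖
      ≤ ‖H * J - J * N‖ := by
    intro s
    rw [CStarRing.norm_mul_mem_unitary _ (evol_mem_unitary hN s),
      CStarRing.norm_mem_unitary_mul _ (evol_mem_unitary hH _), norm_neg, norm_smul]
    simp
  have h := Convex.norm_image_sub_le_of_norm_hasDerivWithin_le (s := Set.univ) (x := 0) (y := t)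
    (fun s _ => (hd s).hasDerivWithinAt) (fun s _ => hb s) convex_univ trivial trivial
  have h4 : J * evol N t - evol H t * J = evol H t * (f t - f 0) := by
    simp only [hf, neg_zero, evol_zero, one_mul, mul_one, mul_sub]
    rw [mul_assoc (evol H (-t)), ← mul_assoc (evol H t), evol_mul_evol_neg, one_mul]
  rw [norm_sub_rev, h4, CStarRing.norm_mem_unitary_mul _ (evol_mem_unitary hH t)]
  rw [sub_zero, Real.norm_of_nonneg ht] at h
  linarith

lemma norm_evol_mul_sub_mul_evol_le {H N : R} (hH : IsSelfAdjoint H) (hN : IsSelfAdjoint N)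
    (P J : R) {t : ℝ} (ht : 0 ≤ t) :
    ‖evol H t * P - P * evol N t‖ ≤ 2 * ‖J - P‖ + t * ‖H * J - J * N‖ := by
  have h : evol H t * P - P * evol N t = (J - P) * evol N t - evol H t * (J - P)
      + (evol H t * J - J * evol N t) := by noncomm_ring
  rw [h]
  refine (norm_add_le _ _).trans (add_le_add ?_ (norm_evol_mul_sub_le hH hN J ht))
  refine (norm_sub_le _ _).trans ?_
  rw [CStarRing.norm_mul_mem_unitary _ (evol_mem_unitary hN t),
    CStarRing.norm_mem_unitary_mul _ (evol_mem_unitary hH t)]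
  linarith

lemma norm_star_mul_sub_star_mul_le (a b : R) :
    ‖star a * a - star b * b‖ ≤ ‖a - b‖ * (‖a‖ + ‖b‖) := by
  have h : star a * a - star b * b = star (a - b) * a + star b * (a - b) := by
    rw [star_sub]; noncomm_ring
  rw [h]
  calc _ ≤ ‖star (a - b)‖ * ‖a‖ + ‖star b‖ * ‖a - b‖ :=
        (norm_add_le _ _).trans (add_le_add (norm_mul_le _ _) (norm_mul_le _ _))
    _ = _ := by rw [norm_star, norm_star]; ring

/-- If a unitary commuting with `X` moves `E` almost to a multiple of `F`, and `X` acts on `E`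
and `F` approximately like `C`, then `E` and `F` have almost the same second moment of `C`. -/
lemma norm_second_moment_sub_le {X U J P C E F : R} {θ : ℂ} {ε η : ℝ}
    (hX : IsSelfAdjoint X) (hU : U ∈ unitary R) (hUX : Commute U X)
    (hPC : P * C = C) (hPE : P * E = E) (hPF : P * F = F) (hE : ‖E‖ ≤ 1) (hF : ‖F‖ ≤ 1)
    (hθ : ‖θ‖ ≤ 1) (hP : ‖P‖ ≤ 1) (hε : ε ≤ 1) (hJ : ‖J - P‖ ≤ ε) (hXJ : ‖X * J - J * C‖ ≤ ε)
    (hη : ‖U * E - θ • F‖ ≤ η) :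
    ‖star (C * E) * (C * E) - star (θ • (C * F)) * (θ • (C * F))‖
      ≤ (η + ε) * (100 * (‖C‖ + 1) ^ 2) := by
  have hε0 : 0 ≤ ε := (norm_nonneg _).trans hJ
  have hη0 : 0 ≤ η := (norm_nonneg _).trans hη
  set c := ‖C‖ with hc
  have hc0 : 0 ≤ c := norm_nonneg _
  set r := X * J - J * C with hr
  have hXJ' : X * J = J * C + r := by rw [hr]; abel
  have hJ2 : ‖J‖ ≤ 2 := by
    have : J = (J - P) + P := by abel
    rw [this]; exact (norm_add_le _ _).trans (by linarith)
  have hmul : ∀ a b : R, ∀ α β : ℝ, ‖a‖ ≤ α → ‖b‖ ≤ β → ‖a * b‖ ≤ α * β := fun a b α β h1 h2 =>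
    (norm_mul_le _ _).trans (mul_le_mul h1 h2 (norm_nonneg _) ((norm_nonneg _).trans h1))
  have hU1 : ∀ a : R, ‖U * a‖ = ‖a‖ := fun a => CStarRing.norm_mem_unitary_mul _ hU
  have hUs : star U * U = 1 := Unitary.star_mul_self_of_mem hU
  have hθs : ∀ a : R, ‖θ • a‖ ≤ ‖a‖ := fun a => by
    rw [norm_smul]; exact mul_le_of_le_one_left (norm_nonneg _) hθ
  -- Here `f` and `g` are close, and `X f`, `X g` are bounded because `X` almost acts as `C` on the
  -- range of `J`. As `U` is unitary and commutes with `X`, the second moment of `X f` is that of `X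
  -- J E`.
  set f := U * (J * E) with hf
  set g := θ • (J * F) with hg
  have hXf : X * f = U * ((J * C + r) * E) := by
    rw [hf, ← mul_assoc, ← hUX.eq, mul_assoc, ← mul_assoc X, hXJ']
  have hXg : X * g = θ • ((J * C + r) * F) := by
    rw [hg, mul_smul_comm, ← mul_assoc, hXJ']
  have hh : ‖J * C + r‖ ≤ 2 * c + 1 :=
    (norm_add_le _ _).trans (add_le_add (hmul _ _ _ _ hJ2 le_rfl) (hXJ.trans hε))
  have hhE : ‖(J * C + r) * E‖ ≤ 2 * c + 1 := by simpa using hmul _ _ _ _ hh hE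
  have hhF : ‖(J * C + r) * F‖ ≤ 2 * c + 1 := by simpa using hmul _ _ _ _ hh hF
  have hdh : ‖(J * C + r) - C‖ ≤ ε * (c + 1) := by
    have : (J * C + r) - C = (J - P) * C + r := by rw [sub_mul, hPC]; abel
    rw [this]
    refine (norm_add_le _ _).trans ?_
    have := hmul _ _ _ _ hJ (le_refl c)
    linarith
  have hfg : ‖f - g‖ ≤ η + 2 * ε := by
    have : f - g = (U * E - θ • F) + (U * ((J - P) * E) - θ • ((J - P) * F)) := by
      rw [hf, hg, sub_mul, sub_mul, hPE, hPF, mul_sub, smul_sub]; abel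
    rw [this]
    refine (norm_add_le _ _).trans (add_le_add hη ((norm_sub_le _ _).trans ?_))
    rw [hU1]
    have h1 := hmul _ _ _ _ hJ hE
    have h2 := (hθs _).trans (hmul _ _ _ _ hJ hF)
    linarith
  have hXfn : ‖X * f‖ ≤ 2 * c + 1 := by rw [hXf, hU1]; exact hhE
  have hXgn : ‖X * g‖ ≤ 2 * c + 1 := by rw [hXg]; exact (hθs _).trans hhF
  have hXfg : ‖X * (f - g)‖ ≤ 2 * (2 * c + 1) := by
    rw [mul_sub]; exact (norm_sub_le _ _).trans (by linarith)
  have hXJC : ‖X * (J * C)‖ ≤ (2 * c + 1) * c := by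
    rw [← mul_assoc, hXJ']; exact hmul _ _ _ _ hh le_rfl
  -- No bound on `‖X‖` is available, so smallness of `f - g` does not make `X (f - g)` small.
  -- Self-adjointness moves `X` to the left factor, where `X J C` is bounded; the part with `r` is
  -- already small and needs only boundedness of `X (f - g)`.
  have hbil : ∀ Z : R, ‖Z‖ ≤ 1 → ∀ S : R, ‖S‖ ≤ 1 → Commute X S →
      ‖star (S * ((J * C + r) * Z)) * (X * (f - g))‖
      ≤ (2 * c + 1) * c * (η + 2 * ε) + ε * (2 * (2 * c + 1)) := by
    intro Z hZ S hS hXS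
    have : star (S * ((J * C + r) * Z)) * (X * (f - g))
        = star (S * (X * (J * C) * Z)) * (f - g) + star (S * (r * Z)) * (X * (f - g)) := by
      have h1 : S * (X * (J * C) * Z) = X * (S * (J * C * Z)) := by
        rw [mul_assoc X, ← mul_assoc S, ← hXS.eq, mul_assoc X]
      rw [h1, star_mul X, hX.star_eq, mul_assoc _ X, ← add_mul, ← star_add, ← mul_add, ← add_mul]
    rw [this]
    have hSZ : ∀ Y : R, ∀ α, ‖Y‖ ≤ α → ‖star (S * (Y * Z))‖ ≤ α := fun Y α hY => by
      rw [norm_star]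
      simpa using hmul _ _ _ _ hS (hmul _ _ _ _ hY hZ)
    exact (norm_add_le _ _).trans (add_le_add (hmul _ _ _ _ (hSZ _ _ hXJC) hfg)
      (hmul _ _ _ _ (hSZ _ _ hXJ) hXfg))
  have hUn : ‖U‖ ≤ 1 := by
    have h1 := CStarRing.norm_star_mul_self (x := U)
    rw [hUs] at h1
    have h2 : ‖(1 : R)‖ ≤ 1 := by
      rcases subsingleton_or_nontrivial R with h | h
      · rw [Subsingleton.elim (1 : R) 0, norm_zero]; exact zero_le_one
      · exact CStarRing.norm_one.le
    nlinarith [norm_nonneg U]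
  have key : ‖star (X * f) * (X * f) - star (X * g) * (X * g)‖
      ≤ 2 * ((2 * c + 1) * c * (η + 2 * ε) + ε * (2 * (2 * c + 1))) := by
    have h1 : star (X * f) * (X * f) - star (X * g) * (X * g)
        = star (X * f) * (X * (f - g)) + star (star (X * g) * (X * (f - g))) := by
      rw [star_mul (star (X * g)), star_star, mul_sub, star_sub]; noncomm_ring
    have h2 := hbil E hE U hUn hUX.symm
    have h3 : ‖star (X * g) * (X * (f - g))‖
        ≤ (2 * c + 1) * c * (η + 2 * ε) + ε * (2 * (2 * c + 1)) := by
      have h4 := hbil F hF (θ • (1 : R)) (by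
        rw [norm_smul]
        rcases subsingleton_or_nontrivial R with h | h
        · rw [Subsingleton.elim (1 : R) 0, norm_zero, mul_zero]; exact zero_le_one
        · rw [CStarRing.norm_one, mul_one]; exact hθ)
        ((Commute.one_right X).smul_right θ)
      rwa [smul_mul_assoc, one_mul, ← hXg] at h4
    rw [← hXf] at h2
    rw [h1]
    refine (norm_add_le _ _).trans ?_
    rw [norm_star]
    linarith
  have hCE : ‖C * E‖ ≤ c := by simpa using hmul _ _ _ _ (le_refl c) hE
  have hCF : ‖C * F‖ ≤ c := by simpa using hmul _ _ _ _ (le_refl c) hF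
  have kE : ‖star (C * E) * (C * E) - star (X * f) * (X * f)‖ ≤ ε * (c + 1) * (3 * c + 1) := by
    have h1 : star (X * f) * (X * f) = star ((J * C + r) * E) * ((J * C + r) * E) := by
      rw [hXf, star_mul, mul_assoc, ← mul_assoc (star U), hUs, one_mul]
    rw [h1]
    refine (norm_star_mul_sub_star_mul_le _ _).trans ?_
    rw [← sub_mul, ← norm_neg, ← neg_mul, neg_sub]
    have h2 := hmul _ _ _ _ hdh hE
    rw [mul_one] at h2
    exact mul_le_mul h2 (by linarith) (by positivity) (by positivity)
  have kF : ‖star (X * g) * (X * g) - star (θ • (C * F)) * (θ • (C * F))‖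
      ≤ ε * (c + 1) * (3 * c + 1) := by
    rw [hXg]
    refine (norm_star_mul_sub_star_mul_le _ _).trans ?_
    rw [← smul_sub, ← sub_mul]
    have h2 := (hθs _).trans (hmul _ _ _ _ hdh hF)
    rw [mul_one] at h2
    have h3 := (hθs _).trans hhF
    have h4 := (hθs _).trans hCF
    exact mul_le_mul h2 (by linarith) (by positivity) (by positivity)
  have htot : star (C * E) * (C * E) - star (θ • (C * F)) * (θ • (C * F))
      = (star (C * E) * (C * E) - star (X * f) * (X * f))
        + (star (X * f) * (X * f) - star (X * g) * (X * g))
        + (star (X * g) * (X * g) - star (θ • (C * F)) * (θ • (C * F))) := by abel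
  rw [htot]
  refine (norm_add_le _ _).trans ((add_le_add ((norm_add_le _ _).trans (add_le_add kE key))
    kF).trans ?_)
  have hηc : 0 ≤ η * c := by positivity
  have hηc2 : 0 ≤ η * c ^ 2 := by positivity
  have hεc : 0 ≤ ε * c := by positivity
  have hεc2 : 0 ≤ ε * c ^ 2 := by positivity
  nlinarith

end Evolution

/-! ### Comparison of the graph evolution with the coupling matrix. -/

section Approximation

open scoped Matrix.Norms.L2Operator

variable {V : Type*} [Fintype V] [DecidableEq V]

lemma norm_entry_le_l2_opNorm (X : Matrix V V ℂ) (u v : V) : ‖X u v‖ ≤ ‖X‖ := by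
  have h := Matrix.l2_opNorm_mulVec X (EuclideanSpace.single v (1 : ℂ))
  rw [PiLp.norm_single, norm_one, mul_one] at h
  refine le_trans ?_ h
  refine le_trans (le_of_eq ?_) (PiLp.norm_apply_le _ u)
  simp

lemma norm_single_one_le (u v : V) : ‖(Matrix.single u v (1 : ℂ) : Matrix V V ℂ)‖ ≤ 1 := by
  have h := Matrix.l2_opNorm_conjTranspose_mul_self (Matrix.single u v (1 : ℂ))
  rw [Matrix.conjTranspose_single, Matrix.single_mul_single_same, star_one, one_mul,
    ← Matrix.diagonal_single, Matrix.l2_opNorm_diagonal] at h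
  have h2 : ‖(Pi.single v 1 : V → ℂ)‖ ≤ 1 := by
    refine (pi_norm_le_iff_of_nonneg zero_le_one).2 fun w => ?_
    by_cases hw : w = v
    · subst hw; simp
    · simp [hw]
  nlinarith [norm_nonneg (Matrix.single u v (1 : ℂ))]

/-- Column `u` of a unitary matrix is a unit vector; deleting its `v`-coordinate leaves squared
length `1 - ‖U v u‖ ^ 2`. -/
lemma norm_sub_single_sq_le {U : Matrix V V ℂ} (hU : U ∈ unitary (Matrix V V ℂ)) (u v : V) :
    ‖U * Matrix.single u u 1 - U v u • Matrix.single v u (1 : ℂ)‖ ^ 2 ≤ 1 - ‖U v u‖ ^ 2 := by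
  set θ := U v u with hθ
  have hUs : U.conjTranspose * U = 1 := Unitary.star_mul_self_of_mem hU
  have h1 : (U * Matrix.single u u 1 - θ • Matrix.single v u (1 : ℂ)).conjTranspose
      * (U * Matrix.single u u 1 - θ • Matrix.single v u (1 : ℂ))
      = ((1 : ℂ) - star θ * θ) • Matrix.single u u 1 := by
    have e1 : Matrix.single u u (1 : ℂ) * U.conjTranspose * Matrix.single v u 1
        = star θ • Matrix.single u u 1 := by
      rw [Matrix.single_mul_mul_single]; simp [hθ, Matrix.smul_single]
    have e2 : Matrix.single u v (1 : ℂ) * U * Matrix.single u u 1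
        = θ • Matrix.single u u 1 := by
      rw [Matrix.single_mul_mul_single]; simp [hθ, Matrix.smul_single]
    simp only [Matrix.conjTranspose_sub, Matrix.conjTranspose_mul, Matrix.conjTranspose_smul,
      Matrix.conjTranspose_single, star_one, sub_mul, mul_sub]
    rw [mul_assoc _ _ (U * _), ← mul_assoc U.conjTranspose, hUs, one_mul, Matrix.mul_smul, e1,
      Matrix.smul_mul, ← mul_assoc, e2, Matrix.smul_mul, Matrix.mul_smul]
    simp only [Matrix.single_mul_single_same, mul_one, smul_smul, sub_smul, one_smul]
    rw [mul_comm θ (star θ)]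
    abel
  have h2 := Matrix.l2_opNorm_conjTranspose_mul_self
    (U * Matrix.single u u 1 - θ • Matrix.single v u (1 : ℂ))
  have h3 : ((1 : ℂ) - star θ * θ) = ((1 - ‖θ‖ ^ 2 : ℝ) : ℂ) := by
    push_cast
    rw [← Complex.conj_mul' θ]; rfl
  have h4 : ‖θ‖ ≤ 1 := by
    have := entry_norm_bound_of_unitary (𝕜 := ℂ) (U := U) hU v u
    exact this
  rw [h1, h3, norm_smul, Complex.norm_real, Real.norm_of_nonneg (by nlinarith [norm_nonneg θ])]
    at h2
  rw [sq, ← h2]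
  exact mul_le_of_le_one_right (by nlinarith [norm_nonneg θ]) (norm_single_one_le u u)

/-- A real matrix regarded as a complex one. -/
abbrev complexify (X : Matrix V V ℝ) : Matrix V V ℂ := X.map fun r : ℝ => (r : ℂ)

lemma complexify_eq (X : Matrix V V ℝ) : complexify X = Complex.ofRealHom.mapMatrix X := rfl

lemma complexify_mul (X Y : Matrix V V ℝ) :
    complexify (X * Y) = complexify X * complexify Y := by
  simp only [complexify_eq, map_mul]

lemma complexify_add (X Y : Matrix V V ℝ) :
    complexify (X + Y) = complexify X + complexify Y := by
  simp only [complexify_eq, map_add]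

lemma complexify_sub (X Y : Matrix V V ℝ) :
    complexify (X - Y) = complexify X - complexify Y := by
  simp only [complexify_eq, map_sub]

lemma complexify_one : complexify (1 : Matrix V V ℝ) = 1 := by
  simp only [complexify_eq, map_one]

lemma complexify_pow (X : Matrix V V ℝ) (k : ℕ) : complexify (X ^ k) = complexify X ^ k := by
  simp only [complexify_eq, map_pow]

lemma complexify_smul (r : ℝ) (X : Matrix V V ℝ) : complexify (r • X) = r • complexify X := by
  ext u v
  simp

lemma isSelfAdjoint_complexify {X : Matrix V V ℝ} (hX : X.transpose = X) :
    IsSelfAdjoint (complexify X) := by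
  rw [isSelfAdjoint_iff]
  ext u v
  have h : X v u = X u v := congrFun (congrFun hX u) v
  simp [Matrix.star_apply, h]

variable (G : SimpleGraph V) [DecidableRel G.Adj] (L : Finset V)

lemma hamiltonian_eq (Q : ℝ) :
    hamiltonian G (wellPotential L) Q = 1 - (Q • wellProj L + normAdj G) := by
  rw [hamiltonian, laplacian_eq, wellProj, ← Matrix.diagonal_smul]
  have : (fun v => Q * wellPotential L v) = Q • wellPotential L := rfl
  rw [this]
  abel

lemma hamiltonian_transpose (Q : ℝ) :
    (hamiltonian G (wellPotential L) Q).transpose = hamiltonian G (wellPotential L) Q := by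
  rw [hamiltonian_eq]
  simp [normAdj_transpose, wellProj]

lemma state_apply (W : V → ℝ) (Q : ℝ) (u v : V) (t : ℝ) :
    state G W Q u t v = evol (complexify (hamiltonian G W Q)) t v u := by
  rw [state, Matrix.mulVec_single_one]
  rfl

/-- The limiting amplitude of a transition between wells in rescaled time. -/
def wellAmplitude (u v : V) (τ : ℝ) : ℂ := evol (-complexify (coupling G L)) τ v u

variable {G L}

lemma norm_complexify_wellProj_le : ‖complexify (wellProj L)‖ ≤ 1 := by
  have h : complexify (wellProj L) = Matrix.diagonal fun v => ((wellPotential L v : ℝ) : ℂ) := by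
    ext u v
    by_cases h : u = v
    · subst h; simp [wellProj]
    · simp [wellProj, h]
  rw [h, Matrix.l2_opNorm_diagonal]
  refine (pi_norm_le_iff_of_nonneg zero_le_one).2 fun w => ?_
  by_cases hw : w ∈ L <;> simp [wellPotential, hw]

lemma exists_quasiMode_hamiltonian (hG : G.Connected) {n : ℕ}
    (hL : ∀ u ∈ L, ∀ v ∈ L, u ≠ v → G.dist u v = n + 1)
    (hA : ∀ u ∈ L, ∀ v ∈ L, ∀ k ≤ n + 1, (normAdj G ^ k) u u = (normAdj G ^ k) v v) :
    ∃ K Q₀ : ℝ, 0 ≤ K ∧ 1 ≤ Q₀ ∧ ∀ Q ≥ Q₀, ∃ (μ : ℝ) (J : Matrix V V ℂ),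
      ‖J - complexify (wellProj L)‖ ≤ K / Q ∧
      ‖(1 - complexify (hamiltonian G (wellPotential L) Q)) * J
        - J * ((μ : ℂ) • 1 + (((Q ^ n)⁻¹ : ℝ) : ℂ) • complexify (coupling G L))‖
        ≤ K / Q ^ (n + 1) := by
  obtain ⟨s, hs, hn⟩ := exists_wellProj_avoiding hG hL hA
  have hs' := fun k hk => congrArg complexify (hs k hk)
  have hn' := congrArg complexify hn
  simp only [complexify_mul, avoiding, complexify_pow, complexify_sub, complexify_one,
    complexify_smul, complexify_add] at hs' hn'
  obtain ⟨K, Q₀, hK, hQ₀, h⟩ := exists_quasiMode (R := Matrix V V ℂ)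
    (A := complexify (normAdj G)) (P := complexify (wellProj L))
    (C := complexify (coupling G L)) (n := n) (s := s)
    (by rw [← complexify_mul, wellProj_mul_self])
    (by rw [← complexify_mul, wellProj_mul_coupling]) hs' hn'
  refine ⟨K, Q₀, hK, hQ₀, fun Q hQ => ?_⟩
  obtain ⟨μ, J, h1, h2⟩ := h Q hQ
  refine ⟨μ, J, h1, ?_⟩
  rw [hamiltonian_eq, complexify_sub, complexify_one, sub_sub_cancel, complexify_add,
    complexify_smul]
  exact h2

lemma wellProj_mul_single {w : V} (hw : w ∈ L) (v : V) :
    complexify (wellProj L) * Matrix.single w v (1 : ℂ) = Matrix.single w v 1 := by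
  ext i j
  rw [Matrix.mul_apply, Finset.sum_eq_single i]
  · by_cases h : w = i
    · subst h; simp [wellProj, wellPotential, hw]
    · simp [h]
  · intro k _ hk
    simp [wellProj, hk.symm]
  · simp

lemma mul_wellProj_apply {v : V} (hv : v ∈ L) (X : Matrix V V ℂ) (u : V) :
    (X * complexify (wellProj L)) u v = X u v := by
  rw [Matrix.mul_apply, Finset.sum_eq_single v]
  · simp [wellProj, wellPotential, hv]
  · intro k _ hk
    simp [wellProj, hk]
  · simp

lemma wellProj_mul_apply {u : V} (hu : u ∈ L) (X : Matrix V V ℂ) (v : V) :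
    (complexify (wellProj L) * X) u v = X u v := by
  rw [Matrix.mul_apply, Finset.sum_eq_single u]
  · simp [wellProj, wellPotential, hu]
  · intro k _ hk
    simp [wellProj, hk.symm]
  · simp

/-- Up to small errors, transitions between wells are governed by the coupling matrix in the
time scale `Q^n`. -/
theorem abs_norm_state_sub_le (hG : G.Connected) {n : ℕ}
    (hL : ∀ u ∈ L, ∀ v ∈ L, u ≠ v → G.dist u v = n + 1)
    (hA : ∀ u ∈ L, ∀ v ∈ L, ∀ k ≤ n + 1, (normAdj G ^ k) u u = (normAdj G ^ k) v v) :
    ∃ K Q₀ : ℝ, 0 ≤ K ∧ 1 ≤ Q₀ ∧ ∀ Q ≥ Q₀, ∀ t ≥ 0, ∀ u ∈ L, ∀ v ∈ L,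
      |‖state G (wellPotential L) Q u t v‖ - ‖wellAmplitude G L u v (t * (Q ^ n)⁻¹)‖|
        ≤ K / Q + t * (K / Q ^ (n + 1)) := by
  obtain ⟨K, Q₀, hK, hQ₀, h⟩ := exists_quasiMode_hamiltonian hG hL hA
  refine ⟨2 * K, Q₀, by positivity, hQ₀, fun Q hQ t ht u hu v hv => ?_⟩
  obtain ⟨μ, J, h1, h2⟩ := h Q hQ
  set H := complexify (hamiltonian G (wellPotential L) Q) with hHdef
  set C := complexify (coupling G L) with hCdef
  set P := complexify (wellProj L) with hPdef
  -- The sign of `C` flips because `H = 1 - (Q P + A)`. The scalar `1 - μ` contributes only a phase,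
  -- and the factor `Q^{-n}` is a change of time.
  set N : Matrix V V ℂ := ((1 - μ : ℝ) : ℂ) • 1 + (((Q ^ n)⁻¹ : ℝ) : ℂ) • (-C) with hNdef
  have hH : IsSelfAdjoint H := isSelfAdjoint_complexify (hamiltonian_transpose G L Q)
  have hC : IsSelfAdjoint C := isSelfAdjoint_complexify coupling_transpose
  have hreal : ∀ r : ℝ, IsSelfAdjoint (r : ℂ) := fun r => Complex.conj_ofReal r
  have hN : IsSelfAdjoint N :=
    ((hreal _).smul (IsSelfAdjoint.one _)).add ((hreal _).smul hC.neg)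
  have h3 : ‖H * J - J * N‖ ≤ K / Q ^ (n + 1) := by
    have e : H * J - J * N = -((1 - H) * J
        - J * ((μ : ℂ) • 1 + (((Q ^ n)⁻¹ : ℝ) : ℂ) • C)) := by
      rw [hNdef, Complex.ofReal_sub, Complex.ofReal_one]
      simp only [sub_mul, mul_add, sub_smul, one_smul, mul_sub, one_mul, mul_one, smul_neg, mul_neg]
      abel
    rw [e]
    exact (norm_neg _).trans_le h2
  have h4 := norm_evol_mul_sub_mul_evol_le hH hN P J ht
  have h5 := norm_entry_le_l2_opNorm (evol H t * P - P * evol N t) v u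
  rw [Matrix.sub_apply, mul_wellProj_apply hu, wellProj_mul_apply hv] at h5
  have h6 : ‖evol N t v u‖ = ‖wellAmplitude G L u v (t * (Q ^ n)⁻¹)‖ := by
    rw [hNdef, evol_smul_one_add, evol_smul, Matrix.smul_apply, norm_smul]
    have : Complex.I * t * ((1 - μ : ℝ) : ℂ) = ((t * (1 - μ) : ℝ) : ℂ) * Complex.I := by
      push_cast; ring
    rw [this, Complex.norm_exp_ofReal_mul_I, one_mul]
    rfl
  rw [state_apply, ← h6]
  refine (abs_norm_sub_norm_le _ _).trans (h5.trans (h4.trans ?_))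
  have h7 : K / Q ^ (n + 1) ≤ 2 * K / Q ^ (n + 1) := by
    have : 0 < Q := by linarith
    gcongr; linarith
  calc 2 * ‖J - P‖ + t * ‖H * J - J * N‖ ≤ 2 * (K / Q) + t * (2 * K / Q ^ (n + 1)) := by
        gcongr; exact h3.trans h7
    _ = _ := by ring

lemma norm_state_le_one (W : Finset V) (Q : ℝ) (u v : V) (t : ℝ) :
    ‖state G (wellPotential W) Q u t v‖ ≤ 1 := by
  rw [state_apply]
  exact entry_norm_bound_of_unitary (𝕜 := ℂ)
    (evol_mem_unitary (isSelfAdjoint_complexify (hamiltonian_transpose G W Q)) t) v u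

/-- If the squared coupling matrix distinguishes two wells, the transition probability stays
away from `1` for all times. -/
theorem exists_prob_le_of_coupling_sq_ne (hG : G.Connected) {n : ℕ}
    (hL : ∀ u ∈ L, ∀ v ∈ L, u ≠ v → G.dist u v = n + 1)
    (hA : ∀ u ∈ L, ∀ v ∈ L, ∀ k ≤ n + 1, (normAdj G ^ k) u u = (normAdj G ^ k) v v)
    {y z : V} (hy : y ∈ L) (hz : z ∈ L)
    (hyz : (coupling G L * coupling G L) y y ≠ (coupling G L * coupling G L) z z) :
    ∃ m < 1, ∃ Q₀ : ℝ, ∀ Q ≥ Q₀, ∀ t : ℝ, prob G (wellPotential L) Q y z t ≤ m := by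
  obtain ⟨K, Q₀, hK, hQ₀, h⟩ := exists_quasiMode_hamiltonian hG hL hA
  set C := complexify (coupling G L) with hCdef
  set P := complexify (wellProj L) with hPdef
  have hC : IsSelfAdjoint C := isSelfAdjoint_complexify coupling_transpose
  set B := 100 * (‖C‖ + 1) ^ 2 with hB
  have hB0 : 0 < B := by positivity
  set α := (coupling G L * coupling G L) y y with hα
  set β := (coupling G L * coupling G L) z z with hβ
  set Γ := |α - β| with hΓ
  have hΓ0 : 0 < Γ := abs_pos.2 (sub_ne_zero.2 hyz)
  have hB' : 0 < B + |β| := by positivity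
  -- Chosen so that the errors proportional to `η₀` total at most `Γ / 4`; the error `B K / Q` takes
  -- at most another `Γ / 4` for large `Q`, which contradicts a moment gap of `Γ`.
  set η₀ := min 1 (Γ / (4 * (B + |β|))) with hη₀
  have hη₀0 : 0 < η₀ := lt_min one_pos (by positivity)
  have hη₀1 : η₀ ≤ 1 := min_le_left _ _
  have hη₀2 : η₀ * (B + |β|) ≤ Γ / 4 := by
    have := min_le_right 1 (Γ / (4 * (B + |β|)))
    rw [← hη₀, le_div_iff₀ (by positivity)] at this
    linarith
  refine ⟨1 - η₀ ^ 2, by nlinarith, max Q₀ (max K (4 * K * B / Γ)), fun Q hQ t => ?_⟩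
  have hQ1 : Q₀ ≤ Q := (le_max_left _ _).trans hQ
  have hQ2 : K ≤ Q := (le_max_left _ _).trans ((le_max_right _ _).trans hQ)
  have hQ3 : 4 * K * B / Γ ≤ Q := (le_max_right _ _).trans ((le_max_right _ _).trans hQ)
  have hQ0 : 0 < Q := by linarith
  obtain ⟨μ, J, h1, h2⟩ := h Q hQ1
  set H := complexify (hamiltonian G (wellPotential L) Q) with hHdef
  have hH : IsSelfAdjoint H := isSelfAdjoint_complexify (hamiltonian_transpose G L Q)
  set U := evol H t with hUdef
  have hU : U ∈ unitary (Matrix V V ℂ) := evol_mem_unitary hH t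
  -- The recentred and rescaled Hamiltonian commutes with the evolution at every time and acts on
  -- the quasi-modes like `C` up to `K / Q`; hence the bound is uniform in `t`.
  set X : Matrix V V ℂ := ((Q ^ n : ℝ) : ℂ) • (1 - H - (μ : ℂ) • 1) with hXdef
  have hreal : ∀ r : ℝ, IsSelfAdjoint (r : ℂ) := fun r => Complex.conj_ofReal r
  have hX : IsSelfAdjoint X := (hreal _).smul
    (((IsSelfAdjoint.one _).sub hH).sub ((hreal _).smul (IsSelfAdjoint.one _)))
  have hUX : Commute U X := by
    refine commute_evol ?_ t
    exact ((((Commute.one_right H).sub_right (Commute.refl H)).sub_right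
      ((Commute.one_right H).smul_right _)).smul_right _)
  have hXJ : ‖X * J - J * C‖ ≤ K / Q := by
    have e : X * J - J * C = ((Q ^ n : ℝ) : ℂ) • ((1 - H) * J
        - J * ((μ : ℂ) • 1 + (((Q ^ n)⁻¹ : ℝ) : ℂ) • C)) := by
      have hQn : ((Q ^ n : ℝ) : ℂ) ≠ 0 := Complex.ofReal_ne_zero.2 (pow_pos hQ0 n).ne'
      rw [hXdef, smul_mul_assoc, sub_mul _ _ J, mul_add, sub_add_eq_sub_sub, smul_sub _ _ (J * _),
        mul_smul_comm _ J C, smul_smul, Complex.ofReal_inv, mul_inv_cancel₀ hQn, one_smul,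
        smul_mul_assoc, mul_smul_comm, one_mul, mul_one]
    rw [e, norm_smul, Complex.norm_real, Real.norm_of_nonneg (by positivity)]
    calc Q ^ n * _ ≤ Q ^ n * (K / Q ^ (n + 1)) := by gcongr
      _ = K / Q := by rw [pow_succ]; field_simp
  set θ := U z y with hθdef
  have hθ : ‖θ‖ ≤ 1 := entry_norm_bound_of_unitary (𝕜 := ℂ) hU z y
  have hprob : prob G (wellPotential L) Q y z t = ‖θ‖ ^ 2 := by rw [prob, state_apply]
  rw [hprob]
  by_contra! hcon
  have hη : ‖U * Matrix.single y y 1 - θ • Matrix.single z y (1 : ℂ)‖ ≤ η₀ := by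
    refine abs_le_of_sq_le_sq' ?_ hη₀0.le |>.2
    linarith [norm_sub_single_sq_le hU y z]
  have hε1 : K / Q ≤ 1 := (div_le_one hQ0).2 hQ2
  have key := norm_second_moment_sub_le hX hU hUX
    (by rw [← complexify_mul, wellProj_mul_coupling] : P * C = C)
    (wellProj_mul_single hy y) (wellProj_mul_single hz y) (norm_single_one_le _ _)
    (norm_single_one_le _ _) hθ norm_complexify_wellProj_le hε1 h1 hXJ hη
  rw [← hB] at key
  have hmom : ∀ w : V, star (C * Matrix.single w y (1 : ℂ)) * (C * Matrix.single w y 1)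
      = (((coupling G L * coupling G L) w w : ℝ) : ℂ) • Matrix.single y y 1 := by
    intro w
    rw [star_mul, hC.star_eq, Matrix.star_eq_conjTranspose, Matrix.conjTranspose_single, mul_assoc,
      ← mul_assoc C C, ← complexify_mul, ← mul_assoc, Matrix.single_mul_mul_single,
      Matrix.smul_single]
    simp
  have h5 := norm_entry_le_l2_opNorm (star (C * Matrix.single y y (1 : ℂ)) * (C * Matrix.single y y 1)
    - star (θ • (C * Matrix.single z y (1 : ℂ))) * (θ • (C * Matrix.single z y 1))) y y
  have h6 : star (θ • (C * Matrix.single z y (1 : ℂ))) * (θ • (C * Matrix.single z y 1))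
      = ((‖θ‖ ^ 2 * β : ℝ) : ℂ) • Matrix.single y y 1 := by
    rw [star_smul, smul_mul_smul_comm, hmom, smul_smul, ← hβ]
    congr 1
    have : star θ * θ = ((‖θ‖ ^ 2 : ℝ) : ℂ) := by
      push_cast; rw [← Complex.conj_mul' θ]; rfl
    rw [this]
    push_cast; ring
  rw [h6, hmom, ← hα, ← sub_smul, ← Complex.ofReal_sub, Matrix.smul_apply,
    Matrix.single_apply_same, smul_eq_mul, mul_one, Complex.norm_real, Real.norm_eq_abs] at h5
  rw [h6, hmom, ← hα, ← sub_smul, ← Complex.ofReal_sub] at key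
  have h7 := h5.trans key
  have h8 : Γ ≤ |α - ‖θ‖ ^ 2 * β| + η₀ * |β| := by
    have e : α - β = (α - ‖θ‖ ^ 2 * β) + -((1 - ‖θ‖ ^ 2) * β) := by ring
    rw [hΓ, e]
    refine (abs_add_le _ _).trans (add_le_add le_rfl ?_)
    rw [abs_neg, abs_mul]
    refine mul_le_mul_of_nonneg_right ?_ (abs_nonneg _)
    rw [abs_of_nonneg (by nlinarith [norm_nonneg θ])]
    nlinarith
  have h9 : K / Q * B ≤ Γ / 4 := by
    rw [div_le_iff₀ hΓ0] at hQ3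
    rw [div_mul_eq_mul_div, div_le_iff₀ hQ0]
    linarith
  have h10 : η₀ * |β| + η₀ * B ≤ Γ / 4 := by linarith
  linarith [add_mul η₀ (K / Q) B]

end Approximation

/-! ### The limiting amplitude of the symmetric triple: arithmetic of its frequencies. -/

section LimitAmplitude

/-- The limiting transition amplitude between two wells that are symmetric with respect to the
third one, up to a phase. -/
def limitAmplitude (b s τ : ℝ) : ℂ :=
  (1 / 2 : ℂ) * (-1 + ((s + b) / (2 * s) : ℝ) * Complex.exp (((-((3 * b + s) / 2 * τ) : ℝ) : ℂ) * Complex.I)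
    + ((s - b) / (2 * s) : ℝ) * Complex.exp (((-((3 * b - s) / 2 * τ) : ℝ) : ℂ) * Complex.I))

lemma continuous_limitAmplitude (b s : ℝ) : Continuous (limitAmplitude b s) := by
  unfold limitAmplitude
  fun_prop

lemma re_limitAmplitude (b s τ : ℝ) : (limitAmplitude b s τ).re
    = (1 / 2) * (-1 + (s + b) / (2 * s) * Real.cos ((3 * b + s) / 2 * τ)
      + (s - b) / (2 * s) * Real.cos ((3 * b - s) / 2 * τ)) := by
  have h : (1 / 2 : ℂ) = ((1 / 2 : ℝ) : ℂ) := by push_cast; rfl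
  rw [limitAmplitude, h, Complex.re_ofReal_mul, Complex.add_re, Complex.add_re,
    Complex.re_ofReal_mul, Complex.re_ofReal_mul, Complex.exp_ofReal_mul_I_re,
    Complex.exp_ofReal_mul_I_re, Real.cos_neg, Real.cos_neg]
  simp

/-- Twice the amplitude is `-1 + p`, with `p` a convex combination of two unit phases. Modulus `2`
forces `p.re ≤ -1`, and both weights are positive because `b < s`, so each cosine is `-1`. -/
lemma cos_eq_neg_one_of_norm_limitAmplitude {b s τ : ℝ} (hb : 0 < b) (hs : b < s)
    (h : 1 ≤ ‖limitAmplitude b s τ‖) :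
    Real.cos ((3 * b + s) / 2 * τ) = -1 ∧ Real.cos ((3 * b - s) / 2 * τ) = -1 := by
  have hs0 : 0 < s := hb.trans hs
  have hα : 0 < (s + b) / (2 * s) := by positivity
  have hβ : 0 < (s - b) / (2 * s) := div_pos (by linarith) (by positivity)
  have hαβ : (s + b) / (2 * s) + (s - b) / (2 * s) = 1 := by field_simp; ring
  have hre := re_limitAmplitude b s τ
  set p : ℂ := ((s + b) / (2 * s) : ℝ) * Complex.exp (((-((3 * b + s) / 2 * τ) : ℝ) : ℂ) * Complex.I)
    + ((s - b) / (2 * s) : ℝ) * Complex.exp (((-((3 * b - s) / 2 * τ) : ℝ) : ℂ) * Complex.I) with hp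
  have hL : limitAmplitude b s τ = (1 / 2 : ℂ) * (-1 + p) := by
    rw [limitAmplitude, hp]; ring
  have hp1 : ‖p‖ ≤ 1 := by
    refine (norm_add_le _ _).trans ?_
    rw [norm_mul, norm_mul, Complex.norm_exp_ofReal_mul_I, Complex.norm_exp_ofReal_mul_I,
      Complex.norm_real, Complex.norm_real, Real.norm_of_nonneg hα.le, Real.norm_of_nonneg hβ.le]
    linarith
  have hpre : p.re ≤ -1 := by
    rw [hL, norm_mul] at h
    have h2 : ‖(1 / 2 : ℂ)‖ = 1 / 2 := by norm_num
    rw [h2] at h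
    have h3 : 2 ^ 2 ≤ ‖-1 + p‖ ^ 2 := by gcongr; linarith
    have h4 : ‖p‖ ^ 2 ≤ 1 ^ 2 := by gcongr
    rw [Complex.sq_norm, Complex.normSq_apply] at h3 h4
    simp at h3
    nlinarith
  have hpre2 : p.re = (s + b) / (2 * s) * Real.cos ((3 * b + s) / 2 * τ)
      + (s - b) / (2 * s) * Real.cos ((3 * b - s) / 2 * τ) := by
    rw [hL] at hre
    have h : (1 / 2 : ℂ) = ((1 / 2 : ℝ) : ℂ) := by push_cast; rfl
    rw [h, Complex.re_ofReal_mul] at hre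
    simp at hre
    linarith
  have c1 := Real.neg_one_le_cos ((3 * b + s) / 2 * τ)
  have c2 := Real.neg_one_le_cos ((3 * b - s) / 2 * τ)
  constructor <;> nlinarith

/-- Both angles are odd multiples of `π`. Half their sum and half their difference (in units of `π`)
have opposite parity; eliminating `τ` gives the relation. -/
lemma exists_odd_relation {b s τ : ℝ} (hb : 0 < b)
    (h1 : Real.cos ((3 * b + s) / 2 * τ) = -1) (h2 : Real.cos ((3 * b - s) / 2 * τ) = -1) :
    ∃ P R : ℤ, P ≠ 0 ∧ Odd (P + R) ∧ s * P = 3 * b * R := by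
  obtain ⟨k, hk⟩ := Real.cos_eq_neg_one_iff.1 h1
  obtain ⟨l, hl⟩ := Real.cos_eq_neg_one_iff.1 h2
  have hπ := Real.pi_pos
  have hτ : τ ≠ 0 := by
    rintro rfl
    rw [mul_zero] at hk
    have : (1 + 2 * k : ℝ) = 0 := by
      have : Real.pi * (1 + 2 * k) = 0 := by linarith
      exact (mul_eq_zero.1 this).resolve_left hπ.ne'
    have h3 : (1 + 2 * k : ℤ) = 0 := by exact_mod_cast this
    omega
  have e1 : 3 * b * τ = 2 * Real.pi * (1 + k + l) := by linarith
  have e2 : s * τ = 2 * Real.pi * (k - l) := by linarith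
  refine ⟨1 + k + l, k - l, ?_, ⟨k, by ring⟩, ?_⟩
  · intro h0
    have h0' : (1 + k + l : ℝ) = 0 := by exact_mod_cast h0
    rw [h0', mul_zero] at e1
    exact (mul_ne_zero (by positivity) hτ) e1
  · push_cast
    refine mul_right_cancel₀ hτ ?_
    linear_combination (1 + k + l : ℝ) * e2 - (k - l : ℝ) * e1

/-- The 2-adic valuation of the left side is odd and that of the right side is zero; the proof is
the usual descent to a fraction not in lowest terms. -/
lemma two_mul_rat_sq_ne_odd {m : ℤ} (hm : Odd m) (q : ℚ) : 2 * q ^ 2 ≠ m := by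
  intro h
  have hd : (q.den : ℚ) ≠ 0 := by exact_mod_cast q.den_ne_zero
  have h1 : 2 * q.num ^ 2 = m * (q.den : ℤ) ^ 2 := by
    have : (2 * q.num ^ 2 : ℚ) = m * (q.den : ℚ) ^ 2 := by
      rw [← h]
      nth_rw 2 [← Rat.num_div_den q]
      field_simp
    exact_mod_cast this
  have hden : Even (q.den : ℤ) := by
    have : Even (m * (q.den : ℤ) ^ 2) := ⟨q.num ^ 2, by rw [← h1]; ring⟩
    rcases Int.even_mul.1 this with h2 | h2
    · exact absurd h2 (Int.not_even_iff_odd.2 hm)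
    · exact (Int.even_pow.1 h2).1
  have hnum : Even q.num := by
    obtain ⟨d, hd⟩ := hden
    rw [hd] at h1
    have : q.num ^ 2 = 2 * (m * d ^ 2) := by nlinarith
    have h3 : Even (q.num ^ 2) := ⟨m * d ^ 2, by rw [this]; ring⟩
    exact (Int.even_pow.1 h3).1
  have hco := q.reduced
  have h2n : 2 ∣ q.num.natAbs := Int.natAbs_dvd_natAbs.2 hnum.two_dvd
  have h2d : 2 ∣ q.den := by exact_mod_cast hden.two_dvd
  have := Nat.dvd_gcd h2n h2d
  rw [hco] at this
  omega

lemma norm_limitAmplitude_lt_one_of_irrational {b s : ℝ} (hb : 0 < b) (hs : b < s)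
    (hbq : ∃ q : ℚ, b = q) (hirr : Irrational s) (τ : ℝ) : ‖limitAmplitude b s τ‖ < 1 := by
  by_contra! h
  obtain ⟨h1, h2⟩ := cos_eq_neg_one_of_norm_limitAmplitude hb hs h
  obtain ⟨P, R, hP, -, hPR⟩ := exists_odd_relation hb h1 h2
  obtain ⟨q, rfl⟩ := hbq
  refine hirr ⟨3 * q * R / P, ?_⟩
  have : (P : ℝ) ≠ 0 := by exact_mod_cast hP
  push_cast
  rw [← hPR]
  field_simp

lemma norm_limitAmplitude_lt_one_of_rational {b c s : ℝ} (hb : 0 < b) (hs : b < s)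
    (hbq : ∃ q : ℚ, b = q) (hcq : ∃ q : ℚ, c = q) (hsq : s ^ 2 = b ^ 2 + 8 * c ^ 2) (τ : ℝ) :
    ‖limitAmplitude b s τ‖ < 1 := by
  by_contra! h
  obtain ⟨h1, h2⟩ := cos_eq_neg_one_of_norm_limitAmplitude hb hs h
  obtain ⟨P, R, -, hodd, hPR⟩ := exists_odd_relation hb h1 h2
  obtain ⟨q, rfl⟩ := hbq
  obtain ⟨r, rfl⟩ := hcq
  have hm : Odd (9 * R ^ 2 - P ^ 2) := by
    have : 9 * R ^ 2 - P ^ 2 = (3 * R - P) * (3 * R + P) := by ring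
    rw [this]
    obtain ⟨k, hk⟩ := hodd
    exact Odd.mul ⟨k + R - P, by linarith⟩ ⟨k + R, by linarith⟩
  -- Squaring `s P = 3 b R` and inserting `s² = b² + 8c²` gives `2 (2 c P / b)² = 9 R² - P²`, which
  -- is odd since `P + R` is.
  refine two_mul_rat_sq_ne_odd hm (2 * r * P / q) ?_
  have hq : (q : ℝ) ≠ 0 := hb.ne'
  have : (2 * (2 * r * P / q) ^ 2 : ℝ) = 9 * R ^ 2 - P ^ 2 := by
    have e : (s * P) ^ 2 = (3 * q * R) ^ 2 := by rw [hPR]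
    rw [mul_pow, hsq] at e
    field_simp
    linear_combination e
  exact_mod_cast this

lemma exists_norm_limitAmplitude_gt {b s : ℝ} (hb : 0 < b) (hs : b < s)
    (hbq : ∃ q : ℚ, b = q) (hirr : Irrational s) {m : ℝ} (hm : m < 1) :
    ∃ τ ≥ 0, m < ‖limitAmplitude b s τ‖ := by
  have hs0 : 0 < s := hb.trans hs
  have hα : Irrational (s / (3 * b)) := by
    obtain ⟨q, rfl⟩ := hbq
    have hq : q ≠ 0 := by rintro rfl; simp at hb
    have := hirr.div_ratCast (q := 3 * q) (by simpa using hq)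
    push_cast at this
    exact this
  set α := s / (3 * b) with hαdef
  -- By density some `n α + k` is close to `1/2`, which makes `cos (2π n α)` close to `-1`.
  have hdense : Dense (AddSubgroup.closure {α, 1} : Set ℝ) := by
    rw [dense_addSubgroupClosure_pair_iff, div_one]; exact hα
  have hcont : Continuous fun r : ℝ => (1 - Real.cos (2 * Real.pi * r)) / 2 := by fun_prop
  have hopen : IsOpen {r : ℝ | m < (1 - Real.cos (2 * Real.pi * r)) / 2} :=
    isOpen_lt continuous_const hcont
  obtain ⟨r, hr, hmem⟩ := hdense.inter_open_nonempty _ hopen ⟨1 / 2, by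
    have : 2 * Real.pi * (1 / 2) = Real.pi := by ring
    simp only [Set.mem_ofPred_eq, this, Real.cos_pi]
    linarith⟩
  obtain ⟨n, k, hnk⟩ := AddSubgroup.mem_closure_pair.1 hmem
  have hcos : Real.cos (2 * Real.pi * r) = Real.cos (2 * Real.pi * (|(n : ℝ)| * α)) := by
    have h1 : 2 * Real.pi * r = 2 * Real.pi * (n * α) + k * (2 * Real.pi) := by
      rw [← hnk]; simp only [zsmul_eq_mul]; ring
    rw [h1, Real.cos_add_int_mul_two_pi]
    rcases abs_choice (n : ℝ) with h | h
    · rw [h]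
    · rw [h, ← Real.cos_neg]; congr 1; ring
  -- At this time the two angles are `±2π|n|α` modulo `2π`, so both cosines coincide. The absolute
  -- value keeps the time nonnegative.
  refine ⟨4 * Real.pi * |(n : ℝ)| / (3 * b), by positivity, ?_⟩
  have hN : |(n : ℝ)| = ((n.natAbs : ℕ) : ℝ) := by
    rw [Nat.cast_natAbs, Int.cast_abs]
  have e1 : (3 * b + s) / 2 * (4 * Real.pi * |(n : ℝ)| / (3 * b))
      = 2 * Real.pi * (|(n : ℝ)| * α) + (n.natAbs : ℕ) * (2 * Real.pi) := by
    rw [← hN, hαdef]; field_simp; ring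
  have e2 : (3 * b - s) / 2 * (4 * Real.pi * |(n : ℝ)| / (3 * b))
      = -(2 * Real.pi * (|(n : ℝ)| * α)) + (n.natAbs : ℕ) * (2 * Real.pi) := by
    rw [← hN, hαdef]; field_simp; ring
  have hre := re_limitAmplitude b s (4 * Real.pi * |(n : ℝ)| / (3 * b))
  rw [e1, e2, Real.cos_add_nat_mul_two_pi, Real.cos_add_nat_mul_two_pi, Real.cos_neg,
    ← hcos] at hre
  have hαβ : (s + b) / (2 * s) + (s - b) / (2 * s) = 1 := by field_simp; ring
  have hre2 : (limitAmplitude b s (4 * Real.pi * |(n : ℝ)| / (3 * b))).re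
      = -((1 - Real.cos (2 * Real.pi * r)) / 2) := by
    rw [hre]; linear_combination (1 / 2) * Real.cos (2 * Real.pi * r) * hαβ
  have h3 := Complex.abs_re_le_norm (limitAmplitude b s (4 * Real.pi * |(n : ℝ)| / (3 * b)))
  rw [hre2, abs_neg] at h3
  exact lt_of_lt_of_le hr ((le_abs_self _).trans h3)

lemma exists_period_limitAmplitude {b s : ℝ} (hbq : ∃ q : ℚ, b = q) (hsq : ∃ q : ℚ, s = q) :
    ∃ T > 0, Function.Periodic (limitAmplitude b s) T := by
  obtain ⟨q, rfl⟩ := hbq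
  obtain ⟨r, rfl⟩ := hsq
  refine ⟨4 * Real.pi * (q.den * r.den : ℕ), ?_, fun τ => ?_⟩
  · have := Nat.mul_pos q.den_pos r.den_pos
    have h : (0 : ℝ) < (q.den * r.den : ℕ) := by exact_mod_cast this
    have := Real.pi_pos
    positivity
  · have hq : (q : ℝ) * q.den = q.num := by exact_mod_cast Rat.mul_den_eq_num q
    have hr : (r : ℝ) * r.den = r.num := by exact_mod_cast Rat.mul_den_eq_num r
    have key : ∀ A : ℝ, ∀ k : ℤ, A * (4 * Real.pi * (q.den * r.den : ℕ)) = k * (2 * Real.pi) →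
        Complex.exp (((-(A * (τ + 4 * Real.pi * (q.den * r.den : ℕ))) : ℝ) : ℂ) * Complex.I)
          = Complex.exp (((-(A * τ) : ℝ) : ℂ) * Complex.I) := by
      intro A k h
      rw [mul_add, h]
      have e : ((-(A * τ + k * (2 * Real.pi)) : ℝ) : ℂ) * Complex.I
          = ((-(A * τ) : ℝ) : ℂ) * Complex.I + ((-k : ℤ) : ℂ) * (2 * Real.pi * Complex.I) := by
        push_cast; ring
      rw [e, Complex.exp_add, Complex.exp_int_mul_two_pi_mul_I, mul_one]
    unfold limitAmplitude
    rw [key _ (3 * q.num * r.den + r.num * q.den), key _ (3 * q.num * r.den - r.num * q.den)]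
    · push_cast
      rw [← hq, ← hr]; ring
    · push_cast
      rw [← hq, ← hr]; ring

end LimitAmplitude

/-! ### Spectral decomposition of the coupling matrix of three wells. -/

section Wells

open scoped Matrix.Norms.L2Operator

variable {V : Type*} [Fintype V] [DecidableEq V]

/-- This is Duhamel's estimate with vanishing defect, for the scalar generator `r`. -/
lemma evol_mul_of_eigen {X S : Matrix V V ℂ} (hX : IsSelfAdjoint X) {r : ℝ}
    (h : X * S = (r : ℂ) • S) {t : ℝ} (ht : 0 ≤ t) :
    evol X t * S = Complex.exp (Complex.I * t * r) • S := by
  have hN : IsSelfAdjoint ((r : ℂ) • (1 : Matrix V V ℂ)) :=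
    IsSelfAdjoint.smul (Complex.conj_ofReal r) (IsSelfAdjoint.one _)
  have h1 := norm_evol_mul_sub_le hX hN S ht
  rw [mul_smul_comm, mul_one, h, sub_self, norm_zero, mul_zero] at h1
  have h2 := sub_eq_zero.1 (norm_le_zero_iff.1 h1)
  have h3 : evol ((r : ℂ) • (1 : Matrix V V ℂ)) t = Complex.exp (Complex.I * t * r) • 1 := by
    have := evol_smul_one_add r (0 : Matrix V V ℂ) t
    rwa [add_zero, show evol (0 : Matrix V V ℂ) t = 1 by simp [evol]] at this
  rw [h2, h3, mul_smul_comm, mul_one]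

variable {G : SimpleGraph V} [DecidableRel G.Adj]

lemma coupling_apply {L : Finset V} {u v : V} (hu : u ∈ L) (hv : v ∈ L) (huv : u ≠ v) :
    coupling G L u v = geodesicWeight G u v := by
  simp [coupling, hu, hv, huv]

lemma coupling_mul_single {x y z : V} (hxy : x ≠ y) (hxz : x ≠ z) (hyz : y ≠ z) (w : V) :
    complexify (coupling G {x, y, z}) * Matrix.single x w (1 : ℂ)
      = (geodesicWeight G x y : ℂ) • Matrix.single y w 1
        + (geodesicWeight G x z : ℂ) • Matrix.single z w 1 := by
  ext i j
  by_cases hj : j = w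
  · subst hj
    rw [Matrix.mul_single_apply_same]
    by_cases hx : i = x
    · subst hx
      simp [coupling, hxy.symm, hxz.symm]
    · by_cases hy : i = y
      · subst hy
        simp [coupling, hx, hyz.symm, geodesicWeight_symm i x]
      · by_cases hz : i = z
        · subst hz
          simp [coupling, hx, hyz, geodesicWeight_symm i x]
        · simp [coupling, hx, hy, hz, Ne.symm hy, Ne.symm hz]
  · rw [Matrix.mul_single_apply_of_ne _ _ _ _ _ hj]
    simp [Ne.symm hj]

/-- Evaluated at `y` and at `z` after permuting the wells, the two values share the term `c_{yz}²`;
they differ exactly when `c_{xy} ≠ c_{xz}`. -/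
lemma coupling_sq_apply {x y z : V} (hxy : x ≠ y) (hxz : x ≠ z) (hyz : y ≠ z) :
    (coupling G {x, y, z} * coupling G {x, y, z}) x x
      = geodesicWeight G x y ^ 2 + geodesicWeight G x z ^ 2 := by
  rw [Matrix.mul_apply, ← Finset.sum_subset (Finset.subset_univ {x, y, z}),
    Finset.sum_insert (by simp [hxy, hxz]), Finset.sum_pair hyz]
  · simp [coupling, hxy, hxz, hxy.symm, hxz.symm, geodesicWeight_symm y x,
      geodesicWeight_symm z x, sq]
  · intro w _ hw
    have h : coupling G {x, y, z} x w = 0 := by simp only [coupling, Matrix.of_apply, hw]; simp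
    rw [h, zero_mul]

/-- With equal couplings to `x`, the swap of `y` and `z` splits `-C` into the antisymmetric mode
with eigenvalue `b` and two symmetric modes with eigenvalues `-(b ± s)/2`. Factoring out the phase
`e^{iτb}` leaves `limitAmplitude`. -/
lemma norm_wellAmplitude_eq {x y z : V} (hxy : x ≠ y) (hxz : x ≠ z)
    (hyz : y ≠ z) {b c s : ℝ} (hb : geodesicWeight G y z = b) (hcy : geodesicWeight G x y = c)
    (hcz : geodesicWeight G x z = c) (hs0 : 0 < s) (hs : s ^ 2 = b ^ 2 + 8 * c ^ 2) {τ : ℝ}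
    (hτ : 0 ≤ τ) : ‖wellAmplitude G {x, y, z} y z τ‖ = ‖limitAmplitude b s τ‖ := by
  set C := complexify (coupling G {x, y, z}) with hC
  have hCs : IsSelfAdjoint (-C) := (isSelfAdjoint_complexify coupling_transpose).neg
  set ex : Matrix V V ℂ := Matrix.single x y 1 with hex
  set ey : Matrix V V ℂ := Matrix.single y y 1 with hey
  set ez : Matrix V V ℂ := Matrix.single z y 1 with hez
  have hCx : C * ex = (c : ℂ) • ey + (c : ℂ) • ez := by
    rw [hC, hex, coupling_mul_single hxy hxz hyz, hcy, hcz]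
  have hCy : C * ey = (c : ℂ) • ex + (b : ℂ) • ez := by
    have : ({x, y, z} : Finset V) = {y, x, z} := Finset.insert_comm _ _ _
    rw [hC, hey, this, coupling_mul_single hxy.symm hyz hxz, geodesicWeight_symm y x, hcy, hb]
  have hCz : C * ez = (c : ℂ) • ex + (b : ℂ) • ey := by
    have : ({x, y, z} : Finset V) = {z, x, y} := by ext w; simp; tauto
    rw [hC, hez, this, coupling_mul_single hxz.symm hyz.symm hxy, geodesicWeight_symm z x, hcz,
      geodesicWeight_symm z y, hb]
  have hsC : (s : ℂ) ≠ 0 := Complex.ofReal_ne_zero.2 hs0.ne'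
  have hs2 : (s : ℂ) ^ 2 = b ^ 2 + 8 * c ^ 2 := by exact_mod_cast hs
  have e0 : -C * (ey - ez) = (b : ℂ) • (ey - ez) := by
    rw [neg_mul, mul_sub, hCy, hCz]; module
  have ep : -C * ((((s : ℂ) + b) / (2 * s)) • (ey + ez) + (2 * c / s : ℂ) • ex)
      = ((-((b + s) / 2) : ℝ) : ℂ)
        • ((((s : ℂ) + b) / (2 * s)) • (ey + ez) + (2 * c / s : ℂ) • ex) := by
    rw [neg_mul, mul_add, mul_smul_comm, mul_smul_comm, mul_add, hCy, hCz, hCx]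
    push_cast
    match_scalars <;> field_simp <;>
      first | ring1 | linear_combination hs2
  have em : -C * ((((s : ℂ) - b) / (2 * s)) • (ey + ez) - (2 * c / s : ℂ) • ex)
      = ((-((b - s) / 2) : ℝ) : ℂ)
        • ((((s : ℂ) - b) / (2 * s)) • (ey + ez) - (2 * c / s : ℂ) • ex) := by
    rw [neg_mul, mul_sub, mul_smul_comm, mul_smul_comm, mul_add, hCy, hCz, hCx]
    push_cast
    match_scalars <;> field_simp <;>
      first | ring1 | linear_combination hs2 | linear_combination -hs2
  -- The symmetric eigenvectors are normalized so that they add up to `ey + ez`, with cancelling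
  -- components at `x`.
  have hey2 : ey = (1 / 2 : ℂ) • ((ey - ez)
      + ((((s : ℂ) + b) / (2 * s)) • (ey + ez) + (2 * c / s : ℂ) • ex)
      + ((((s : ℂ) - b) / (2 * s)) • (ey + ez) - (2 * c / s : ℂ) • ex)) := by
    match_scalars <;> field_simp <;> ring
  have hU : evol (-C) τ * ey = (1 / 2 : ℂ) • (Complex.exp (Complex.I * τ * b) • (ey - ez)
      + Complex.exp (Complex.I * τ * (-((b + s) / 2) : ℝ))
        • ((((s : ℂ) + b) / (2 * s)) • (ey + ez) + (2 * c / s : ℂ) • ex)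
      + Complex.exp (Complex.I * τ * (-((b - s) / 2) : ℝ))
        • ((((s : ℂ) - b) / (2 * s)) • (ey + ez) - (2 * c / s : ℂ) • ex)) := by
    rw [← evol_mul_of_eigen hCs e0 hτ, ← evol_mul_of_eigen hCs ep hτ,
      ← evol_mul_of_eigen hCs em hτ, ← mul_add, ← mul_add, ← mul_smul_comm, ← hey2]
  have hentry : wellAmplitude G {x, y, z} y z τ = (evol (-C) τ * ey) z y := by
    rw [hey, Matrix.mul_single_apply_same, mul_one]; rfl
  have hfin : wellAmplitude G {x, y, z} y z τ
      = Complex.exp (((τ * b : ℝ) : ℂ) * Complex.I) * limitAmplitude b s τ := by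
    rw [hentry, hU, limitAmplitude]
    simp only [Matrix.smul_apply, Matrix.add_apply, Matrix.sub_apply, hex, hey, hez,
      Matrix.single_apply_same, Matrix.single_apply_of_row_ne hyz,
      Matrix.single_apply_of_row_ne hxz, smul_eq_mul]
    have x1 : Complex.exp (Complex.I * τ * (-((b + s) / 2) : ℝ))
        = Complex.exp (((τ * b : ℝ) : ℂ) * Complex.I)
          * Complex.exp (((-((3 * b + s) / 2 * τ) : ℝ) : ℂ) * Complex.I) := by
      rw [← Complex.exp_add]; congr 1; push_cast; ring
    have x2 : Complex.exp (Complex.I * τ * (-((b - s) / 2) : ℝ))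
        = Complex.exp (((τ * b : ℝ) : ℂ) * Complex.I)
          * Complex.exp (((-((3 * b - s) / 2 * τ) : ℝ) : ℂ) * Complex.I) := by
      rw [← Complex.exp_add]; congr 1; push_cast; ring
    have x3 : Complex.exp (Complex.I * τ * b) = Complex.exp (((τ * b : ℝ) : ℂ) * Complex.I) := by
      congr 1; push_cast; ring
    rw [x1, x2, x3]
    push_cast
    ring
  rw [hfin, norm_mul, Complex.norm_exp_ofReal_mul_I, one_mul]

lemma continuous_wellAmplitude (L : Finset V) (u v : V) : Continuous (wellAmplitude G L u v) := by
  exact Continuous.matrix_elem (continuous_evol (-complexify (coupling G L))) v u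

/-- An amplitude vanishing on `[0, ∞)` would have zero right derivative at `0`, but that derivative
is `-i` times the coupling. -/
lemma exists_wellAmplitude_ne_zero {L : Finset V} {u v : V} (h : coupling G L v u ≠ 0) :
    ∃ τ ≥ 0, wellAmplitude G L u v τ ≠ 0 := by
  by_contra! h0
  have h1 := hasDerivAt_evol (-complexify (coupling G L)) 0
  have h2 : HasDerivAt (wellAmplitude G L u v)
      ((evol (-complexify (coupling G L)) 0 * (Complex.I • -complexify (coupling G L))) v u) 0 :=
    hasDerivAt_pi.1 (hasDerivAt_pi.1 h1 v) u
  have h3 : HasDerivWithinAt (wellAmplitude G L u v) 0 (Set.Ici 0) 0 :=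
    (hasDerivWithinAt_const (0 : ℝ) (Set.Ici 0) (0 : ℂ)).congr (fun τ hτ => h0 τ hτ)
      (h0 0 le_rfl)
  have h4 := (uniqueDiffWithinAt_Ici (0 : ℝ)).eq_deriv _ h2.hasDerivWithinAt h3
  rw [evol_zero, one_mul] at h4
  simp at h4
  exact h h4

end Wells

/-! ### From amplitude estimates to tunneling coefficients and times. -/

section Coefficient

variable {V : Type*} [Fintype V] [DecidableEq V] {G : SimpleGraph V} [DecidableRel G.Adj]
  {L : Finset V} {u v : V}

lemma prob_nonneg (W : V → ℝ) (Q : ℝ) (t : ℝ) : 0 ≤ prob G W Q u v t := sq_nonneg _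

lemma prob_le_one (Q : ℝ) (t : ℝ) : prob G (wellPotential L) Q u v t ≤ 1 :=
  pow_le_one₀ (norm_nonneg _) (norm_state_le_one L Q u v t)

lemma sSup_prob_nonneg (W : V → ℝ) (Q : ℝ) (s : Set ℝ) : 0 ≤ sSup (prob G W Q u v '' s) :=
  Real.sSup_nonneg fun r hr => by
    obtain ⟨t, -, rfl⟩ := hr
    exact prob_nonneg W Q t

lemma sSup_prob_le {W : V → ℝ} {Q : ℝ} {s : Set ℝ} {m : ℝ} (hm : 0 ≤ m)
    (h : ∀ t ∈ s, prob G W Q u v t ≤ m) : sSup (prob G W Q u v '' s) ≤ m :=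
  Real.sSup_le (fun r hr => by
    obtain ⟨t, ht, rfl⟩ := hr
    exact h t ht) hm

lemma sSup_prob_le_one (Q : ℝ) (s : Set ℝ) :
    sSup (prob G (wellPotential L) Q u v '' s) ≤ 1 :=
  sSup_prob_le zero_le_one fun t _ => prob_le_one Q t

lemma le_sSup_prob {Q t : ℝ} {s : Set ℝ} (ht : t ∈ s) :
    prob G (wellPotential L) Q u v t ≤ sSup (prob G (wellPotential L) Q u v '' s) :=
  le_csSup ⟨1, by rintro _ ⟨r, -, rfl⟩; exact prob_le_one Q r⟩ ⟨t, ht, rfl⟩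

lemma isBoundedUnder_sSup_prob (s : ℝ → Set ℝ) :
    IsBoundedUnder (· ≥ ·) atTop
      fun Q => sSup (prob G (wellPotential L) Q u v '' s Q) :=
  isBoundedUnder_of ⟨0, fun Q => sSup_prob_nonneg _ Q _⟩

lemma isCoboundedUnder_sSup_prob (s : ℝ → Set ℝ) :
    IsCoboundedUnder (· ≥ ·) atTop
      fun Q => sSup (prob G (wellPotential L) Q u v '' s Q) :=
  (isBoundedUnder_of ⟨1, fun Q => sSup_prob_le_one Q _⟩ :
    IsBoundedUnder (· ≤ ·) atTop _).isCoboundedUnder_ge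

lemma tunnelingCoefficient_le {m : ℝ} (hm : 0 ≤ m)
    (h : ∀ᶠ Q in atTop, ∀ t ≥ 0, prob G (wellPotential L) Q u v t ≤ m) :
    tunnelingCoefficient G (wellPotential L) u v ≤ m :=
  liminf_le_of_frequently_le (h.mono fun _ hQ => sSup_prob_le hm fun t ht => hQ t ht).frequently
    (isBoundedUnder_sSup_prob _)

lemma le_tunnelingCoefficient {m : ℝ}
    (h : ∀ᶠ Q in atTop, ∃ t ≥ 0, m ≤ prob G (wellPotential L) Q u v t) :
    m ≤ tunnelingCoefficient G (wellPotential L) u v :=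
  le_liminf_of_le (isCoboundedUnder_sSup_prob _) (h.mono fun Q hQ => by
    obtain ⟨t, ht, hm⟩ := hQ
    exact hm.trans (le_sSup_prob (Set.mem_Ici.2 ht)))

/-- Perfect tunneling does not happen within a time during which all transition probabilities
stay away from `1`. -/
lemma eventually_le_of_tunnelsWithin {f g : ℝ → ℝ} {m : ℝ} (hm : m < 1)
    (hp : PerfectTunneling G (wellPotential L) u v)
    (hf : TunnelsWithin G (wellPotential L) u v f)
    (h : ∀ᶠ Q in atTop, ∀ t, 0 ≤ t → t ≤ g Q → prob G (wellPotential L) Q u v t ≤ m) :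
    ∀ᶠ Q in atTop, g Q ≤ f Q := by
  unfold TunnelsWithin at hf
  unfold PerfectTunneling at hp
  rw [hp] at hf
  have hlt : max m 0 < liminf (fun Q : ℝ =>
      sSup (prob G (wellPotential L) Q u v '' Set.Icc 0 (f Q))) atTop := by
    rw [← hf]; exact max_lt hm one_pos
  filter_upwards [eventually_lt_of_lt_liminf hlt (isBoundedUnder_sSup_prob _), h] with Q h1 h2
  by_contra! hfg
  exact absurd h1 (not_lt.2 (sSup_prob_le (le_max_right _ _) fun t ht =>
    (h2 t ht.1 (ht.2.trans hfg.le)).trans (le_max_left _ _)))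

section Limit

variable {n : ℕ} (hG : G.Connected) (hL : ∀ u ∈ L, ∀ v ∈ L, u ≠ v → G.dist u v = n + 1)
  (hA : ∀ u ∈ L, ∀ v ∈ L, ∀ k ≤ n + 1, (normAdj G ^ k) u u = (normAdj G ^ k) v v)
  (hu : u ∈ L) (hv : v ∈ L)
include hG hL hA hu hv

/-- At time `τ Q^n` with `τ` fixed, the approximation error is `(K + τ K) / Q` and vanishes in the
limit. -/
lemma sq_le_tunnelingCoefficient {τ m : ℝ} (hτ : 0 ≤ τ) (hm0 : 0 ≤ m)
    (hm : m < ‖wellAmplitude G L u v τ‖) :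
    m ^ 2 ≤ tunnelingCoefficient G (wellPotential L) u v := by
  obtain ⟨K, Q₀, hK, hQ₀, h⟩ := abs_norm_state_sub_le hG hL hA
  set d := ‖wellAmplitude G L u v τ‖ - m with hd
  have hd0 : 0 < d := sub_pos.2 hm
  refine le_tunnelingCoefficient ?_
  filter_upwards [eventually_ge_atTop Q₀, eventually_ge_atTop ((K + τ * K) / d)] with Q h1 h2
  have hQ : 0 < Q := by linarith
  refine ⟨τ * Q ^ n, by positivity, ?_⟩
  have h3 := h Q h1 (τ * Q ^ n) (by positivity) u hu v hv
  rw [mul_inv_cancel_right₀ (pow_pos hQ n).ne'] at h3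
  have h4 : K / Q + τ * Q ^ n * (K / Q ^ (n + 1)) = (K + τ * K) / Q := by
    rw [pow_succ]; field_simp
  have h5 : (K + τ * K) / Q ≤ d := by
    rw [div_le_iff₀ hQ]
    rw [div_le_iff₀ hd0] at h2
    linarith
  rw [h4] at h3
  have h6 := (abs_le.1 h3).1
  exact pow_le_pow_left₀ hm0 (by linarith) 2

lemma tunnelingCoefficient_pos (huv : u ≠ v) :
    0 < tunnelingCoefficient G (wellPotential L) u v := by
  obtain ⟨τ, hτ, h⟩ := exists_wellAmplitude_ne_zero (G := G) (L := L) (u := u) (v := v) (by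
    rw [coupling_apply hv hu huv.symm]
    exact (geodesicWeight_pos hG v u).ne')
  have h1 := norm_pos_iff.2 h
  have := sq_le_tunnelingCoefficient hG hL hA hu hv hτ (half_pos h1).le (half_lt_self h1)
  exact lt_of_lt_of_le (by positivity) this

lemma perfectTunneling_of_approx
    (h : ∀ m < 1, ∃ τ ≥ 0, m < ‖wellAmplitude G L u v τ‖) :
    PerfectTunneling G (wellPotential L) u v := by
  refine le_antisymm (tunnelingCoefficient_le zero_le_one
    (Eventually.of_forall fun Q t _ => prob_le_one Q t)) ?_
  refine le_of_forall_lt fun r hr => ?_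
  rcases lt_or_ge r 0 with h0 | h0
  · obtain ⟨τ, hτ, hτ0⟩ := h 0 one_pos
    have := sq_le_tunnelingCoefficient hG hL hA hu hv hτ le_rfl hτ0
    exact h0.trans_le (by simpa using this)
  · obtain ⟨m, hm1, hm2⟩ := exists_between hr
    have hm0 : 0 ≤ m := h0.trans hm1.le
    obtain ⟨τ, hτ, hτm⟩ := h (√m) (by rw [Real.sqrt_lt' one_pos]; simpa using hm2)
    have := sq_le_tunnelingCoefficient hG hL hA hu hv hτ (Real.sqrt_nonneg _) hτm
    rw [Real.sq_sqrt hm0] at this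
    exact hm1.trans_le this

/-- On the compact interval `[0, κ⁻¹]` of rescaled time the amplitude has a maximum below `1`, so
perfect tunneling needs time at least `κ⁻¹ Q^n` for large `Q`, for every `κ > 0`. -/
lemma isLittleO_of_tunnelsWithin (h : ∀ τ ≥ 0, ‖wellAmplitude G L u v τ‖ < 1)
    (hp : PerfectTunneling G (wellPotential L) u v) {f : ℝ → ℝ}
    (hf : TunnelsWithin G (wellPotential L) u v f) :
    (fun Q : ℝ => Q ^ n) =o[atTop] f := by
  obtain ⟨K, Q₀, hK, hQ₀, hst⟩ := abs_norm_state_sub_le hG hL hA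
  refine isLittleO_iff.2 fun κ hκ => ?_
  obtain ⟨τ₀, hτ₀, hmax⟩ := (isCompact_Icc (a := (0 : ℝ)) (b := κ⁻¹)).exists_isMaxOn
    ⟨0, Set.left_mem_Icc.2 (inv_pos.2 hκ).le⟩
    (continuous_wellAmplitude (G := G) L u v).norm.continuousOn
  set g₀ := ‖wellAmplitude G L u v τ₀‖ with hg₀
  have hg1 : g₀ < 1 := h τ₀ hτ₀.1
  have hg0 : 0 ≤ g₀ := norm_nonneg _
  have key : ∀ᶠ Q : ℝ in atTop, κ⁻¹ * Q ^ n ≤ f Q := by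
    refine eventually_le_of_tunnelsWithin (m := ((g₀ + 1) / 2) ^ 2)
      (pow_lt_one₀ (by linarith) (by linarith) two_ne_zero) hp hf ?_
    filter_upwards [eventually_ge_atTop Q₀,
      eventually_ge_atTop ((K + κ⁻¹ * K) / ((1 - g₀) / 2))] with Q h1 h2 t ht0 ht
    have hQ : 0 < Q := by linarith
    refine pow_le_pow_left₀ (norm_nonneg _) ?_ 2
    have h3 := (abs_le.1 (hst Q h1 t ht0 u hu v hv)).2
    have h4 : ‖wellAmplitude G L u v (t * (Q ^ n)⁻¹)‖ ≤ g₀ :=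
      hmax ⟨by positivity, by rwa [← div_eq_mul_inv, div_le_iff₀ (by positivity)]⟩
    have h5 : K / Q + t * (K / Q ^ (n + 1)) ≤ (K + κ⁻¹ * K) / Q := by
      calc _ ≤ K / Q + κ⁻¹ * Q ^ n * (K / Q ^ (n + 1)) := by gcongr
        _ = _ := by rw [pow_succ]; field_simp
    have h6 : (K + κ⁻¹ * K) / Q ≤ (1 - g₀) / 2 := by
      rw [div_le_iff₀ hQ]
      rw [div_le_iff₀ (by linarith)] at h2
      linarith
    linarith
  filter_upwards [key, eventually_ge_atTop 0] with Q h1 h2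
  rw [Real.norm_of_nonneg (by positivity)]
  have h3 : Q ^ n ≤ κ * f Q := by
    calc Q ^ n = κ * (κ⁻¹ * Q ^ n) := by rw [mul_inv_cancel_left₀ hκ.ne']
      _ ≤ κ * f Q := by gcongr
  exact h3.trans (by gcongr; exact le_abs_self _)

/-- Since the limiting amplitude never exceeds `g₀`, only the accumulated error `t K / Q^(n+1)` can
bridge the gap, and it needs time of order `Q^(n+1)` for that. -/
lemma isBigO_of_tunnelsWithin {g₀ : ℝ} (hg1 : g₀ < 1)
    (h : ∀ τ ≥ 0, ‖wellAmplitude G L u v τ‖ ≤ g₀)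
    (hp : PerfectTunneling G (wellPotential L) u v) {f : ℝ → ℝ}
    (hf : TunnelsWithin G (wellPotential L) u v f) :
    (fun Q : ℝ => Q ^ (n + 1)) =O[atTop] f := by
  obtain ⟨K, Q₀, hK, hQ₀, hst⟩ := abs_norm_state_sub_le hG hL hA
  have hg0 : 0 ≤ g₀ := (norm_nonneg _).trans (h 0 le_rfl)
  -- Half of the gap `1 - g₀` is shared between the two error terms, a quarter each; `K + 1` avoids
  -- division by zero.
  set δ := (1 - g₀) / (4 * (K + 1)) with hδ
  have hδ0 : 0 < δ := div_pos (by linarith) (by positivity)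
  have hδK : δ * K ≤ (1 - g₀) / 4 := by
    have : δ * (K + 1) = (1 - g₀) / 4 := by rw [hδ]; field_simp
    linarith
  have key : ∀ᶠ Q : ℝ in atTop, δ * Q ^ (n + 1) ≤ f Q := by
    refine eventually_le_of_tunnelsWithin (m := ((g₀ + 1) / 2) ^ 2)
      (pow_lt_one₀ (by linarith) (by linarith) two_ne_zero) hp hf ?_
    filter_upwards [eventually_ge_atTop Q₀,
      eventually_ge_atTop (K / ((1 - g₀) / 4))] with Q h1 h2 t ht0 ht
    have hQ : 0 < Q := by linarith
    refine pow_le_pow_left₀ (norm_nonneg _) ?_ 2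
    have h3 := (abs_le.1 (hst Q h1 t ht0 u hu v hv)).2
    have h4 := h (t * (Q ^ n)⁻¹) (by positivity)
    have h5 : t * (K / Q ^ (n + 1)) ≤ δ * K := by
      calc _ ≤ δ * Q ^ (n + 1) * (K / Q ^ (n + 1)) := by gcongr
        _ = _ := by field_simp
    have h6 : K / Q ≤ (1 - g₀) / 4 := by
      rw [div_le_iff₀ hQ]
      rw [div_le_iff₀ (by linarith)] at h2
      linarith
    linarith
  refine IsBigO.of_bound δ⁻¹ ?_
  filter_upwards [key, eventually_ge_atTop 0] with Q h1 h2
  rw [Real.norm_of_nonneg (by positivity)]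
  calc Q ^ (n + 1) = δ⁻¹ * (δ * Q ^ (n + 1)) := by rw [inv_mul_cancel_left₀ hδ0.ne']
    _ ≤ δ⁻¹ * ‖f Q‖ := by gcongr; exact h1.trans (le_abs_self _)

end Limit

end Coefficient

lemma exists_norm_limitAmplitude_le {b s : ℝ} (hbq : ∃ q : ℚ, b = q) (hsq : ∃ q : ℚ, s = q)
    (h : ∀ τ, ‖limitAmplitude b s τ‖ < 1) : ∃ m < 1, ∀ τ, ‖limitAmplitude b s τ‖ ≤ m := by
  obtain ⟨T, hT, hper⟩ := exists_period_limitAmplitude hbq hsq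
  obtain ⟨τ₀, -, hmax⟩ := (isCompact_Icc (a := (0 : ℝ)) (b := T)).exists_isMaxOn
    ⟨0, Set.left_mem_Icc.2 hT.le⟩ (continuous_limitAmplitude b s).norm.continuousOn
  refine ⟨_, h τ₀, fun τ => ?_⟩
  obtain ⟨σ, hσ, hτσ⟩ := hper.exists_mem_Ico₀ hT τ
  rw [hτσ]
  exact hmax ⟨hσ.1, hσ.2.le⟩

end GraphTunneling

end

/-! ### The three-well theorem. -/

theorem theorem3 {V : Type*} [Fintype V] [DecidableEq V]
    (G : SimpleGraph V) [DecidableRel G.Adj] (hG : G.Connected)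
    (x y z : V) (hxy : x ≠ y) (hxz : x ≠ z) (hyz : y ≠ z)
    (a : ℕ) (dxy : G.dist x y = a) (dxz : G.dist x z = a) (dyz : G.dist y z = a)
    (sxy : GraphTunneling.Cospectral G a x y) (sxz : GraphTunneling.Cospectral G a x z)
    (syz : GraphTunneling.Cospectral G a y z)
    (W : V → ℝ) (hW : W = GraphTunneling.wellPotential {x, y, z})
    (cxy cxz cyz : ℝ) (hcxy : cxy = GraphTunneling.geodesicWeight G x y)
    (hcxz : cxz = GraphTunneling.geodesicWeight G x z)
    (hcyz : cyz = GraphTunneling.geodesicWeight G y z) :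
    (cxy ≠ cxz → GraphTunneling.PartialTunneling G W y z) ∧
    (cxy = cxz → Irrational (Real.sqrt (cyz ^ 2 + 8 * cxz ^ 2)) →
      GraphTunneling.PerfectTunneling G W y z ∧
      ∀ f : ℝ → ℝ, GraphTunneling.TunnelsWithin G W y z f →
        (fun Q : ℝ => Q ^ (a - 1)) =o[atTop] f) ∧
    (cxy = cxz → ¬ Irrational cxz → ¬ Irrational (Real.sqrt (cyz ^ 2 + 8 * cxz ^ 2)) →
      GraphTunneling.PerfectTunneling G W y z →
      ∀ f : ℝ → ℝ, GraphTunneling.TunnelsWithin G W y z f →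
        (fun Q : ℝ => Q ^ a) =O[atTop] f) ∧
    (cxy = cxz → cxz = cyz →
      ¬ Irrational (Real.sqrt (cyz ^ 2 + 8 * cxz ^ 2)) ∧
      (GraphTunneling.PerfectTunneling G W y z →
        ∀ f : ℝ → ℝ, GraphTunneling.TunnelsWithin G W y z f →
          (fun Q : ℝ => Q ^ a) =O[atTop] f)) := by

  subst hW
  have hdeg : ∀ u, 0 < G.degree u := by
    have : Nontrivial V := ⟨x, y, hxy⟩
    exact fun u => hG.preconnected.degree_pos_of_nontrivial u
  -- Distinct wells have positive distance, so `a - 1` is a true subtraction and `Q^n` is the time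
  -- scale `Q^(a-1)`.
  obtain ⟨n, rfl⟩ : ∃ n, a = n + 1 :=
    Nat.exists_eq_succ_of_ne_zero (dxy ▸ (hG.pos_dist_of_ne hxy).ne')
  have hL : ∀ u ∈ ({x, y, z} : Finset V), ∀ v ∈ ({x, y, z} : Finset V), u ≠ v →
      G.dist u v = n + 1 := by
    intro u hu v hv huv
    simp only [Finset.mem_insert, Finset.mem_singleton] at hu hv
    rcases hu with rfl | rfl | rfl <;> rcases hv with rfl | rfl | rfl <;>
      first | exact absurd rfl huv | assumption | (rw [SimpleGraph.dist_comm]; assumption)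
  have hA : ∀ u ∈ ({x, y, z} : Finset V), ∀ v ∈ ({x, y, z} : Finset V), ∀ k ≤ n + 1,
      (GraphTunneling.normAdj G ^ k) u u = (GraphTunneling.normAdj G ^ k) v v := by
    intro u hu v hv k hk
    have h1 := sxy k hk
    have h2 := sxz k hk
    simp only [GraphTunneling.returnProb_eq hdeg] at h1 h2
    simp only [Finset.mem_insert, Finset.mem_singleton] at hu hv
    rcases hu with rfl | rfl | rfl <;> rcases hv with rfl | rfl | rfl <;> simp [← h1, ← h2]
  have hy : y ∈ ({x, y, z} : Finset V) := by simp
  have hz : z ∈ ({x, y, z} : Finset V) := by simp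
  have hb0 : 0 < cyz := hcyz ▸ GraphTunneling.geodesicWeight_pos hG y z
  have hc0 : 0 < cxz := hcxz ▸ GraphTunneling.geodesicWeight_pos hG x z
  have hc0' : 0 < cxy := hcxy ▸ GraphTunneling.geodesicWeight_pos hG x y
  set s := Real.sqrt (cyz ^ 2 + 8 * cxz ^ 2) with hs
  have hs2 : s ^ 2 = cyz ^ 2 + 8 * cxz ^ 2 := Real.sq_sqrt (by positivity)
  have hbs : cyz < s := Real.lt_sqrt_of_sq_lt (by nlinarith)
  have hbq : cxy = cxz → ∃ q : ℚ, cyz = q := fun h => by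
    rw [hcxy, hcxz] at h
    rw [hcyz]
    exact GraphTunneling.exists_rat_geodesicWeight hG hdeg h
  have hamp : cxy = cxz → ∀ τ ≥ 0, ‖GraphTunneling.wellAmplitude G {x, y, z} y z τ‖
      = ‖GraphTunneling.limitAmplitude cyz s τ‖ := fun h τ hτ =>
    GraphTunneling.norm_wellAmplitude_eq hxy hxz hyz hcyz.symm (hcxy.symm.trans h) hcxz.symm
      (hb0.trans hbs) hs2 hτ
  have hrat : ∀ r : ℝ, ¬ Irrational r → ∃ q : ℚ, r = q := fun r hr => by
    obtain ⟨q, hq⟩ := not_not.1 hr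
    exact ⟨q, hq.symm⟩
  have part3 : cxy = cxz → ¬ Irrational cxz → ¬ Irrational s →
      GraphTunneling.PerfectTunneling G (GraphTunneling.wellPotential {x, y, z}) y z →
      ∀ f : ℝ → ℝ, GraphTunneling.TunnelsWithin G (GraphTunneling.wellPotential {x, y, z}) y z f →
        (fun Q : ℝ => Q ^ (n + 1)) =O[atTop] f := by
    intro h hcr hsr hp f hf
    obtain ⟨m, hm, hle⟩ := GraphTunneling.exists_norm_limitAmplitude_le (hbq h) (hrat _ hsr)
      (GraphTunneling.norm_limitAmplitude_lt_one_of_rational hb0 hbs (hbq h) (hrat _ hcr) hs2)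
    exact GraphTunneling.isBigO_of_tunnelsWithin hG hL hA hy hz hm
      (fun τ hτ => by rw [hamp h τ hτ]; exact hle τ) hp hf
  refine ⟨fun hne => ⟨GraphTunneling.tunnelingCoefficient_pos hG hL hA hy hz hyz, ?_⟩,
    fun h hirr => ?_, part3, fun h h' => ?_⟩
  · have h1 := GraphTunneling.coupling_sq_apply (G := G) hxy.symm hyz hxz
    have h2 := GraphTunneling.coupling_sq_apply (G := G) hxz.symm hyz.symm hxy
    rw [show ({y, x, z} : Finset V) = {x, y, z} from Finset.insert_comm _ _ _,
      GraphTunneling.geodesicWeight_symm y x, ← hcxy, ← hcyz] at h1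
    rw [show ({z, x, y} : Finset V) = {x, y, z} by ext w; simp; tauto,
      GraphTunneling.geodesicWeight_symm z x, GraphTunneling.geodesicWeight_symm z y,
      ← hcxz, ← hcyz] at h2
    obtain ⟨m, hm, Q₀, hQ⟩ := GraphTunneling.exists_prob_le_of_coupling_sq_ne hG hL hA hy hz (by
      rw [h1, h2]
      intro h
      exact hne ((sq_eq_sq₀ hc0'.le hc0.le).1 (by linarith)))
    refine lt_of_le_of_lt (GraphTunneling.tunnelingCoefficient_le (le_max_right m 0) ?_)
      (max_lt hm one_pos)
    filter_upwards [eventually_ge_atTop Q₀] with Q hQQ t _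
    exact (hQ Q hQQ t).trans (le_max_left _ _)
  · have hp := GraphTunneling.perfectTunneling_of_approx hG hL hA hy hz fun m hm => by
      obtain ⟨τ, hτ, hlt⟩ := GraphTunneling.exists_norm_limitAmplitude_gt hb0 hbs (hbq h) hirr hm
      exact ⟨τ, hτ, by rwa [hamp h τ hτ]⟩
    refine ⟨hp, fun f hf => GraphTunneling.isLittleO_of_tunnelsWithin hG hL hA hy hz ?_ hp hf⟩
    intro τ hτ
    rw [hamp h τ hτ]
    exact GraphTunneling.norm_limitAmplitude_lt_one_of_irrational hb0 hbs (hbq h) hirr τ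
  · obtain ⟨q, hq⟩ := hbq h
    -- With three equal weights the root is `3 c_{yz}`. Rationality of `c_{yz}` comes from `hbq`, so
    -- it need not be assumed here.
    have hs3 : s = 3 * cyz := by
      rw [hs, h', show cyz ^ 2 + 8 * cyz ^ 2 = (3 * cyz) ^ 2 by ring]
      exact Real.sqrt_sq (by positivity)
    have hsr : ¬ Irrational s := by
      rw [hs3, hq]
      exact fun hi => hi ⟨3 * q, by push_cast; ring⟩
    refine ⟨hsr, part3 h ?_ hsr⟩
    rw [h', hq]
    exact fun hi => hi ⟨q, rfl⟩
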